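/- **Weak PRP/PRF switching lemma.** Consider an untyped call-by-value (right-to-left) language with recursive functions, pairs, sums, higher-order dynamically allocated references, presampling tapes and a command $\mathsf{rand}\,n$ that samples uniformly from $\{0,\dots,n\}$. Write $\mathrm{step}(e,\sigma)$ for its one-step subdistribution on configurations (an expression with a state, i.e. a finite heap and finitely many tapes), and $\mathrm{exec}(e,\sigma)(v)=\lim_n \mathrm{exec}_n(e,\sigma)(v)$ for the probability that $e$, started in state $\sigma$, terminates with value $v$. Fix natural numbers $N\ge 1$ and $Q\ge 0$. * $\mathrm{RF}_N$ is the program that allocates an empty map $m$ and returns the function which, on input $x$, if $m$ has no entry for $x$, samples $y$ with $\mathsf{rand}\,(N-1)$ and sets $m[x]:=y$; it then returns $m[x]$. * $\mathrm{RP}_N$ is the program that allocates an empty map $m$ and a list $u=[0,\dots,N-1]$ and returns the function which, on input $x$, if $m$ has no entry for $x$, samples an index $k$ with $\mathsf{rand}\,(|u|-1)$, lets $y$ be the $k$-th element of $u$, sets $m[x]:=y$ and removes the $k$-th element from $u$; it then returns $m[x]$. * $A(N,Q,f)$ is the program that, starting from the empty list $\ell$, repeats $Q$ times: sample $x$ with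 $\mathsf{rand}\,(N-1)$, let $y=f\,x$, put $(x,y)$ in front of $\ell$; it finally returns $\ell$. Let $\varepsilon_Q=\dfrac{Q(Q-1)}{2N}$. Then: 1. For all initial states $\sigma,\sigma'$ and every value $v$ (in particular for every list of input/output pairs), $$\bigl|\,\mathrm{exec}(A(N,Q,\mathrm{RP}_N),\sigma)(v)-\mathrm{exec}(A(N,Q,\mathrm{RF}_N),\sigma')(v)\,\bigr|\le \frac{Q(Q-1)}{2N}.$$ 2. In the approximate relational separation logic described below, both refinements hold with $\varepsilon_Q$ error credits: $$\mathsf{Cr}(\varepsilon_Q)\vdash A(N,Q,\mathrm{RP}_N)\precsim A(N,Q,\mathrm{RF}_N)\;\{v,v'.\;v=v'\},\qquad \mathsf{Cr}(\varepsilon_Q)\vdash A(N,Q,\mathrm{RF}_N)\precsim A(N,Q,\mathrm{RP}_N)\;\{v,v'.\;v=v'\}.$$ Here the assertions are step-indexed predicates over the authoritative resource algebra of: the heap and tapes of the left program, the expression, heap and tapes of the right program, and error credits (nonnegative reals under addition, valid when $<1$). $\mathsf{Cr}(\varepsilon)$ is ownership of $\varepsilon$ credits, $\mathrm{spec}(e')$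 is ownership of the right-hand expression $e'$, and $S(\sigma,\rho',\varepsilon)$ is the authoritative element recording the left state $\sigma$, the right configuration $\rho'$ and the error budget $\varepsilon$. The refinement assertion is $$e\precsim e'\,\{\Phi\}\;:=\;\forall K.\ \mathrm{spec}(K[e'])\mathrel{-\!\!*}\mathrm{wp}\,e\,\{v.\ \exists v'.\ \mathrm{spec}(K[v'])*\Phi(v,v')\},$$ with $K$ ranging over evaluation contexts, and $\mathrm{wp}$ is the solution of the guarded equation (with $\mathsf{upd}\,$ the update modality and $\triangleright$ the later modality) $$\begin{aligned}\mathrm{wp}\,e_1\{\Psi\}=\forall\sigma_1,\rho_1',\varepsilon_1.\ &S(\sigma_1,\rho_1',\varepsilon_1)\mathrel{-\!\!*}\mathsf{upd}\,\ \mathrm{scpl}_{\sigma_1,\rho_1',\varepsilon_1}\bigl\{\sigma_2,\rho_2',\varepsilon_2.\\ &(\exists v.\,e_1=v\wedge\mathsf{upd}\,(S(\sigma_2,\rho_2',\varepsilon_2)*\Psi(v)))\ \vee\\ &(e_1\notin\mathrm{Val}\wedge\mathrm{pcpl}_{(e_1,\sigma_2),\rho_2',\varepsilon_2}\{(e_2,\sigma_3),\rho_3',\varepsilon_3.\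 \triangleright\,\mathrm{scpl}_{\sigma_3,\rho_3',\varepsilon_3}\{\sigma_4,\rho_4',\varepsilon_4.\ \mathsf{upd}\,(S(\sigma_4,\rho_4',\varepsilon_4)*\mathrm{wp}\,e_2\{\Psi\})\}\})\bigr\}.\end{aligned}$$ An $(\varepsilon,R)$-coupling of subdistributions $\mu_1,\mu_2$ exists if $\mathbb E_{\mu_1}[X]\le\mathbb E_{\mu_2}[Y]+\varepsilon$ for all $[0,1]$-valued $X,Y$ such that $R(a,b)$ implies $X(a)\le Y(b)$. A distribution $\mu$ on states is erasable at $\sigma$ if $\mathrm{exec}_n(e,\sigma)=\mathbb E_{\sigma'\sim\mu}\,\mathrm{exec}_n(e,\sigma')$ for all $e,n$. $\mathrm{pexec}_n(\rho)$ is the distribution of configurations after running $\rho$ for $n$ steps (stopping at values). The precondition $\mathrm{pcpl}_{(e_1,\sigma_1),(e_1',\sigma_1'),\varepsilon}\{\Phi\}$ holds if $(e_1,\sigma_1)$ is reducible and there are $R$, $n$, $\varepsilon_1$, $E_2$ with values in $[0,1]$, and $\mu'$ erasable at $\sigma_1'$, such that $\mathrm{step}(e_1,\sigma_1)$ and $\nu=\mathbb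 E_{\sigma_2'\sim\mu'}\,\mathrm{pexec}_n(e_1',\sigma_2')$ are $(\varepsilon_1,R)$-coupled, $\varepsilon_1+\mathbb E_{\mathrm{step}(e_1,\sigma_1)}[E_2]\le\varepsilon$, and for all $(\rho_2,\rho_2')\in R$, after an update, $\Phi(\rho_2,\rho_2',E_2(\rho_2))$. The precondition $\mathrm{scpl}_{\sigma_1,(e_1',\sigma_1'),\varepsilon}\{\Phi\}$ is the least predicate that holds if $\varepsilon\ge1$, or if $\Phi(\sigma_1,(e_1',\sigma_1'),\varepsilon)$ holds, or if there are $R,n,\varepsilon_1,E_2,\mu'$ as before and $\mu$ erasable at $\sigma_1$ such that $\mu$ and $\nu$ are $(\varepsilon_1,R)$-coupled, $\varepsilon_1+\mathbb E_\nu[E_2]\le\varepsilon$, and for all $(\sigma_2,\rho_2')\in R$, after an update, $\mathrm{scpl}_{\sigma_2,\rho_2',E_2(\rho_2')}\{\Phi\}$. -/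

import Mathlib

open scoped ENNReal NNReal

namespace ProbLang

/-! ## Discrete subdistributions and approximate couplings -/

/-- A discrete subdistribution: a mass function of total mass at most one. -/
structure SubDistr (A : Type) where
  mass : A → ℝ≥0∞
  sum_le_one : ∑' a, mass a ≤ 1

namespace SubDistr

variable {A B : Type}

instance : CoeFun (SubDistr A) (fun _ => A → ℝ≥0∞) := ⟨SubDistr.mass⟩

/-- The empty subdistribution. -/
def zero : SubDistr A := ⟨fun _ => 0, by simp⟩

open Classical in
/-- The Dirac distribution. -/
noncomputable def ret (a : A) : SubDistr A :=
  ⟨fun b => if b = a then 1 else 0, by rw [tsum_ite_eq]⟩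

/-- Monadic bind of subdistributions. -/
noncomputable def bind (μ : SubDistr A) (f : A → SubDistr B) : SubDistr B :=
  ⟨fun b => ∑' a, μ a * f a b, by
    rw [ENNReal.tsum_comm]
    calc ∑' a, ∑' b, μ a * f a b = ∑' a, μ a * ∑' b, f a b := by
          simp_rw [ENNReal.tsum_mul_left]
      _ ≤ ∑' a, μ a * 1 :=
          ENNReal.tsum_le_tsum fun a => mul_le_mul_right (f a).sum_le_one _
      _ ≤ 1 := by simpa using μ.sum_le_one⟩

/-- Push-forward along a function. -/
noncomputable def map (f : A → B) (μ : SubDistr A) : SubDistr B :=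
  μ.bind fun a => ret (f a)

/-- The uniform distribution on `{0, …, N}`. -/
noncomputable def unif (N : ℕ) : SubDistr (Fin (N + 1)) :=
  ⟨fun _ => ((N : ℝ≥0∞) + 1)⁻¹, by
    rw [tsum_fintype]
    simp only [Finset.sum_const, Finset.card_univ, Fintype.card_fin, nsmul_eq_mul, Nat.cast_add,
      Nat.cast_one]
    exact ENNReal.mul_inv_le_one _⟩

theorem mass_le_one (μ : SubDistr A) (a : A) : μ a ≤ 1 :=
  (ENNReal.le_tsum a).trans μ.sum_le_one

/-- Expected value of a nonnegative random variable. -/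
noncomputable def expect (μ : SubDistr A) (X : A → ℝ≥0∞) : ℝ≥0∞ := ∑' a, μ a * X a

end SubDistr

/-- There is an `(ε, R)`-coupling of `μ₁` and `μ₂`. -/
def ARCoupl {A B : Type} (μ₁ : SubDistr A) (μ₂ : SubDistr B) (ε : ℝ≥0)
    (R : A → B → Prop) : Prop :=
  ∀ (X : A → ℝ≥0∞) (Y : B → ℝ≥0∞), (∀ a, X a ≤ 1) → (∀ b, Y b ≤ 1) →
    (∀ a b, R a b → X a ≤ Y b) → μ₁.expect X ≤ μ₂.expect Y + ε

/-! ## The language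

An untyped call-by-value language with recursive functions, pairs, sums, a dynamically allocated
higher-order heap (with contiguous blocks), uniform sampling and presampling tapes. Program
variables are natural numbers, a binder is an optional variable. The type-level constructs
(packing, type abstraction) have no computational content and are not separate constructors. -/

/-- Heap locations. -/
abbrev Loc : Type := ℤ

/-- Tape labels. -/
abbrev Lbl : Type := ℕ

/-- Binders; `none` is the anonymous binder. -/
abbrev Binder : Type := Option ℕ

inductive UnOp
  | neg
  | minus
  deriving DecidableEq

inductive BinOp
  | add | sub | mul | quot | rem | and | or | lt | le | eq | offset
  deriving DecidableEq

mutual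
/-- Values. -/
inductive Val
  | int (z : ℤ)
  | bool (b : Bool)
  | unit
  | loc (l : Loc)
  | lbl (κ : Lbl)
  | fix (f x : Binder) (e : Expr)
  | pair (v w : Val)
  | inl (v : Val)
  | inr (v : Val)
/-- Expressions. -/
inductive Expr
  | val (v : Val)
  | var (x : ℕ)
  | fix (f x : Binder) (e : Expr)
  | app (e₁ e₂ : Expr)
  | unop (op : UnOp) (e : Expr)
  | binop (op : BinOp) (e₁ e₂ : Expr)
  | ite (e e₁ e₂ : Expr)
  | pair (e₁ e₂ : Expr)
  | fst (e : Expr)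
  | snd (e : Expr)
  | inl (e : Expr)
  | inr (e : Expr)
  | case (e e₁ e₂ : Expr)
  | allocN (e₁ e₂ : Expr)
  | load (e : Expr)
  | store (e₁ e₂ : Expr)
  | allocTape (e : Expr)
  | rand (e : Expr)
  | randT (e₁ e₂ : Expr)
end

/-- The value that an expression is, if it is one. -/
def Expr.toVal : Expr → Option Val
  | .val v => some v
  | _ => none

/-- Substitution of a (closed) value for a variable. -/
def Expr.subst (x : ℕ) (v : Val) : Expr → Expr
  | .val w => .val w
  | .var y => if x = y then .val v else .var y
  | .fix f y e => if some x ≠ f ∧ some x ≠ y then .fix f y (e.subst x v) else .fix f y e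
  | .app e₁ e₂ => .app (e₁.subst x v) (e₂.subst x v)
  | .unop op e => .unop op (e.subst x v)
  | .binop op e₁ e₂ => .binop op (e₁.subst x v) (e₂.subst x v)
  | .ite e e₁ e₂ => .ite (e.subst x v) (e₁.subst x v) (e₂.subst x v)
  | .pair e₁ e₂ => .pair (e₁.subst x v) (e₂.subst x v)
  | .fst e => .fst (e.subst x v)
  | .snd e => .snd (e.subst x v)
  | .inl e => .inl (e.subst x v)
  | .inr e => .inr (e.subst x v)
  | .case e e₁ e₂ => .case (e.subst x v) (e₁.subst x v) (e₂.subst x v)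
  | .allocN e₁ e₂ => .allocN (e₁.subst x v) (e₂.subst x v)
  | .load e => .load (e.subst x v)
  | .store e₁ e₂ => .store (e₁.subst x v) (e₂.subst x v)
  | .allocTape e => .allocTape (e.subst x v)
  | .rand e => .rand (e.subst x v)
  | .randT e₁ e₂ => .randT (e₁.subst x v) (e₂.subst x v)

/-- Substitution for a binder. -/
def Expr.substB (b : Binder) (v : Val) (e : Expr) : Expr :=
  match b with
  | none => e
  | some x => e.subst x v

/-- A presampling tape: a bound `N` and a list of elements of `{0, …, N}`. -/
abbrev Tape : Type := Σ N : ℕ, List (Fin (N + 1))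

/-- States: a finite heap and finitely many tapes. -/
structure State where
  heap : Finmap (fun _ : Loc => Val)
  tapes : Finmap (fun _ : Lbl => Tape)

/-- Configurations. -/
abbrev Conf : Type := Expr × State

/-- A location such that it and all larger ones are unallocated. -/
def freshLoc (h : Finmap (fun _ : Loc => Val)) : Loc :=
  h.keys.fold max 0 (fun l => l + 1)

/-- A tape label that is not in use. -/
def freshLbl (t : Finmap (fun _ : Lbl => Tape)) : Lbl :=
  t.keys.fold max 0 (fun κ => κ + 1)

/-- Write `v` at the `n` consecutive locations from `l` on. -/
def heapBlock (l : Loc) (v : Val) : ℕ → Finmap (fun _ : Loc => Val) → Finmap (fun _ : Loc => Val)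
  | 0, h => h
  | n + 1, h => (heapBlock l v n h).insert (l + n) v

/-- Values that may be compared with arbitrary values. -/
def Val.IsUnboxed : Val → Prop
  | .int _ | .bool _ | .unit | .loc _ | .lbl _ => True
  | .inl (.int _) | .inl (.bool _) | .inl .unit | .inl (.loc _) | .inl (.lbl _) => True
  | .inr (.int _) | .inr (.bool _) | .inr .unit | .inr (.loc _) | .inr (.lbl _) => True
  | _ => False

def unopEval : UnOp → Val → Option Val
  | .neg, .bool b => some (.bool (!b))
  | .minus, .int z => some (.int (-z))
  | _, _ => none

open Classical in
noncomputable def binopEval : BinOp → Val → Val → Option Val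
  | .add, .int a, .int b => some (.int (a + b))
  | .sub, .int a, .int b => some (.int (a - b))
  | .mul, .int a, .int b => some (.int (a * b))
  | .quot, .int a, .int b => some (.int (a.tdiv b))
  | .rem, .int a, .int b => some (.int (a.tmod b))
  | .and, .bool a, .bool b => some (.bool (a && b))
  | .or, .bool a, .bool b => some (.bool (a || b))
  | .lt, .int a, .int b => some (.bool (decide (a < b)))
  | .le, .int a, .int b => some (.bool (decide (a ≤ b)))
  | .eq, v, w => if v.IsUnboxed ∨ w.IsUnboxed then some (.bool (decide (v = w))) else none
  | .offset, .loc l, .int z => some (.loc (l + z))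
  | _, _, _ => none

/-- A deterministic outcome, or no outcome if the operation is undefined. -/
noncomputable def retOpt : Option Conf → SubDistr Conf
  | some ρ => .ret ρ
  | none => .zero

/-- Uniform sampling from `{0, …, N}` that leaves the state alone. -/
noncomputable def unifStep (N : ℕ) (σ : State) : SubDistr Conf :=
  (SubDistr.unif N).map fun n : Fin (N + 1) => (.val (.int (n : ℕ)), σ)

/-- Head reduction. The empty subdistribution means that the expression is stuck. -/
noncomputable def headStep : Expr → State → SubDistr Conf
  | .fix f x e, σ => .ret (.val (.fix f x e), σ)
  | .app (.val (.fix f x e)) (.val v), σ =>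
      .ret ((e.substB x v).substB f (.fix f x e), σ)
  | .unop op (.val v), σ => retOpt ((unopEval op v).map fun w => (.val w, σ))
  | .binop op (.val v) (.val w), σ => retOpt ((binopEval op v w).map fun u => (.val u, σ))
  | .ite (.val (.bool b)) e₁ e₂, σ => .ret (if b then e₁ else e₂, σ)
  | .pair (.val v) (.val w), σ => .ret (.val (.pair v w), σ)
  | .fst (.val (.pair v _)), σ => .ret (.val v, σ)
  | .snd (.val (.pair _ w)), σ => .ret (.val w, σ)
  | .inl (.val v), σ => .ret (.val (.inl v), σ)
  | .inr (.val v), σ => .ret (.val (.inr v), σ)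
  | .case (.val (.inl v)) e₁ _, σ => .ret (.app e₁ (.val v), σ)
  | .case (.val (.inr v)) _ e₂, σ => .ret (.app e₂ (.val v), σ)
  | .allocN (.val (.int n)) (.val v), σ =>
      if 0 < n then
        .ret (.val (.loc (freshLoc σ.heap)),
          { σ with heap := heapBlock (freshLoc σ.heap) v n.toNat σ.heap })
      else .zero
  | .load (.val (.loc l)), σ => retOpt ((σ.heap.lookup l).map fun v => (.val v, σ))
  | .store (.val (.loc l)) (.val w), σ =>
      retOpt ((σ.heap.lookup l).map fun _ =>
        (.val .unit, { σ with heap := σ.heap.insert l w }))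
  | .allocTape (.val (.int N)), σ =>
      if 0 ≤ N then
        .ret (.val (.lbl (freshLbl σ.tapes)),
          { σ with tapes := σ.tapes.insert (freshLbl σ.tapes) ⟨N.toNat, []⟩ })
      else .zero
  | .rand (.val (.int N)), σ => if 0 ≤ N then unifStep N.toNat σ else .zero
  | .randT (.val (.int N)) (.val (.lbl κ)), σ =>
      if 0 ≤ N then
        match σ.tapes.lookup κ with
        | none => .zero
        | some ⟨_, []⟩ => unifStep N.toNat σ
        | some ⟨M, n :: w⟩ =>
            if M = N.toNat then
              .ret (.val (.int (n : ℕ)), { σ with tapes := σ.tapes.insert κ ⟨M, w⟩ })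
            else unifStep N.toNat σ
      else .zero
  | _, _ => .zero

/-- Frames of evaluation contexts; evaluation is from right to left. -/
inductive Frame
  | appR (e₁ : Expr)
  | appL (v₂ : Val)
  | unop (op : UnOp)
  | binopR (op : BinOp) (e₁ : Expr)
  | binopL (op : BinOp) (v₂ : Val)
  | ite (e₁ e₂ : Expr)
  | pairR (e₁ : Expr)
  | pairL (v₂ : Val)
  | fst
  | snd
  | inl
  | inr
  | case (e₁ e₂ : Expr)
  | allocNR (e₁ : Expr)
  | allocNL (v₂ : Val)
  | load
  | storeR (e₁ : Expr)
  | storeL (v₂ : Val)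
  | allocTape
  | rand
  | randTR (e₁ : Expr)
  | randTL (v₂ : Val)

/-- Plug an expression into a frame. -/
def Frame.fill : Frame → Expr → Expr
  | .appR e₁, e => .app e₁ e
  | .appL v₂, e => .app e (.val v₂)
  | .unop op, e => .unop op e
  | .binopR op e₁, e => .binop op e₁ e
  | .binopL op v₂, e => .binop op e (.val v₂)
  | .ite e₁ e₂, e => .ite e e₁ e₂
  | .pairR e₁, e => .pair e₁ e
  | .pairL v₂, e => .pair e (.val v₂)
  | .fst, e => .fst e
  | .snd, e => .snd e
  | .inl, e => .inl e
  | .inr, e => .inr e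
  | .case e₁ e₂, e => .case e e₁ e₂
  | .allocNR e₁, e => .allocN e₁ e
  | .allocNL v₂, e => .allocN e (.val v₂)
  | .load, e => .load e
  | .storeR e₁, e => .store e₁ e
  | .storeL v₂, e => .store e (.val v₂)
  | .allocTape, e => .allocTape e
  | .rand, e => .rand e
  | .randTR e₁, e => .randT e₁ e
  | .randTL v₂, e => .randT e (.val v₂)

/-- Evaluation contexts, as lists of frames with the outermost frame first. -/
abbrev Ectx : Type := List Frame

def Ectx.fill (K : Ectx) (e : Expr) : Expr := K.foldr Frame.fill e

/-- The frame `F` around `e` if `e` is not a value; otherwise continue with its value. -/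
def focus (e : Expr) (F : Frame) (k : Val → Option (Frame × Expr)) : Option (Frame × Expr) :=
  match e.toVal with
  | none => some (F, e)
  | some v => k v

/-- The outermost frame and the immediate subexpression in evaluation position, if there is a
subexpression that is still to be evaluated. -/
def Expr.decomp : Expr → Option (Frame × Expr)
  | .app e₁ e₂ => focus e₂ (.appR e₁) fun v => focus e₁ (.appL v) fun _ => none
  | .unop op e => focus e (.unop op) fun _ => none
  | .binop op e₁ e₂ => focus e₂ (.binopR op e₁) fun v => focus e₁ (.binopL op v) fun _ => none
  | .ite e e₁ e₂ => focus e (.ite e₁ e₂) fun _ => none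
  | .pair e₁ e₂ => focus e₂ (.pairR e₁) fun v => focus e₁ (.pairL v) fun _ => none
  | .fst e => focus e .fst fun _ => none
  | .snd e => focus e .snd fun _ => none
  | .inl e => focus e .inl fun _ => none
  | .inr e => focus e .inr fun _ => none
  | .case e e₁ e₂ => focus e (.case e₁ e₂) fun _ => none
  | .allocN e₁ e₂ => focus e₂ (.allocNR e₁) fun v => focus e₁ (.allocNL v) fun _ => none
  | .load e => focus e .load fun _ => none
  | .store e₁ e₂ => focus e₂ (.storeR e₁) fun v => focus e₁ (.storeL v) fun _ => none
  | .allocTape e => focus e .allocTape fun _ => none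
  | .rand e => focus e .rand fun _ => none
  | .randT e₁ e₂ => focus e₂ (.randTR e₁) fun v => focus e₁ (.randTL v) fun _ => none
  | _ => none

theorem Expr.decomp_fill {e e' : Expr} {F : Frame} (h : e.decomp = some (F, e')) :
    F.fill e' = e := by
  cases e <;> simp only [Expr.decomp, focus, reduceCtorEq] at h <;>
    (repeat' split at h) <;> simp_all [Expr.toVal] <;>
    (obtain ⟨rfl, rfl⟩ := h; simp [Frame.fill]) <;>
    (rename_i hv; revert hv; cases ‹Expr› <;> simp_all)

theorem Frame.sizeOf_lt_fill (F : Frame) (e : Expr) : sizeOf e < sizeOf (F.fill e) := by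
  cases F <;> simp [Frame.fill] <;> omega

/-- Single step reduction: a head reduction in an evaluation context. -/
noncomputable def step (e : Expr) (σ : State) : SubDistr Conf :=
  match _h : e.decomp with
  | some (F, e') => (step e' σ).map fun ρ => (F.fill ρ.1, ρ.2)
  | none => headStep e σ
termination_by sizeOf e
decreasing_by
  rw [← Expr.decomp_fill _h]
  exact Frame.sizeOf_lt_fill F e'

/-- A configuration is reducible if it steps to some configuration with positive probability. -/
def Reducible (ρ : Conf) : Prop := ∃ ρ', 0 < step ρ.1 ρ.2 ρ'

/-- The distribution of the value reached within `n` steps. -/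
noncomputable def execN : ℕ → Conf → SubDistr Val
  | 0, (e, _) =>
    match e.toVal with
    | some v => .ret v
    | none => .zero
  | n + 1, (e, σ) =>
    match e.toVal with
    | some v => .ret v
    | none => (step e σ).bind (execN n)

/-- The probability that a configuration reaches the value `v`: the limit (supremum) of the
nondecreasing sequence `execN n ρ v`. -/
noncomputable def exec (ρ : Conf) (v : Val) : ℝ≥0∞ := ⨆ n, execN n ρ v

theorem exec_le_one (ρ : Conf) (v : Val) : exec ρ v ≤ 1 :=
  iSup_le fun n => (execN n ρ).mass_le_one v

/-- `n` steps of partial execution. -/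
noncomputable def pexec : ℕ → Conf → SubDistr Conf
  | 0, ρ => .ret ρ
  | n + 1, (e, σ) =>
    match e.toVal with
    | some _ => .ret (e, σ)
    | none => (step e σ).bind (pexec n)

/-- Replacing `σ` by a sample from `μ` does not change the outcome of any execution. -/
def Erasable (μ : SubDistr State) (σ : State) : Prop :=
  ∀ (e : Expr) (n : ℕ), execN n (e, σ) = μ.bind fun σ' => execN n (e, σ')

/-! ## Resources

The composition of resources is written additively. -/

/-- The exclusive resource algebra over `X`, with a unit and an invalid element. -/
inductive Ex (X : Type)
  | unit
  | own (x : X)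
  | bot

namespace Ex

variable {X : Type}

/-- Composition; two ownerships never compose. -/
protected def add : Ex X → Ex X → Ex X
  | .unit, y => y
  | x, .unit => x
  | _, _ => .bot

instance : Zero (Ex X) := ⟨.unit⟩

instance : Add (Ex X) := ⟨Ex.add⟩

instance : AddCommMonoid (Ex X) where
  add_assoc a b c := by cases a <;> cases b <;> cases c <;> rfl
  zero_add a := by cases a <;> rfl
  add_zero a := by cases a <;> rfl
  add_comm a b := by cases a <;> cases b <;> rfl
  nsmul := nsmulRec

def ofOption : Option X → Ex X
  | none => .unit
  | some x => .own x

end Ex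

/-- Knowledge about: the heap and the tapes of the left-hand side, the program, the heap and the
tapes of the right-hand side, and a number of error credits. -/
abbrev Frag : Type :=
  (Loc → Ex Val) × (Lbl → Ex Tape) × Ex Expr × (Loc → Ex Val) × (Lbl → Ex Tape) × ℝ≥0

/-- Nothing is owned twice, and there are fewer than `1` error credits. -/
def Frag.Valid : Frag → Prop
  | (h, t, e, h', t', c) =>
    (∀ l, h l ≠ .bot) ∧ (∀ κ, t κ ≠ .bot) ∧ e ≠ .bot ∧ (∀ l, h' l ≠ .bot) ∧
      (∀ κ, t' κ ≠ .bot) ∧ c < 1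

/-- The authoritative resource algebra over `Frag`: an optional authoritative element and a
fragment. -/
abbrev Res : Type := Ex Frag × Frag

/-- The fragment has to be a part of the authoritative element, which has to be valid. -/
def Res.Valid : Res → Prop
  | (.unit, b) => b.Valid
  | (.own a, b) => (∃ c, a = b + c) ∧ a.Valid
  | (.bot, _) => False

/-! ## The base logic: step-indexed predicates over resources -/

structure IProp where
  holds : ℕ → Res → Prop
  mono : ∀ {n n' : ℕ} {a c : Res}, n' ≤ n → holds n a → holds n' (a + c)

namespace IProp

/-- Entailment. -/
def Entails (P Q : IProp) : Prop :=
  ∀ (n : ℕ) (a : Res), a.Valid → P.holds n a → Q.holds n a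

/-- Embedding of a proposition of the ambient logic. -/
def pure (φ : Prop) : IProp := ⟨fun _ _ => φ, fun _ h => h⟩

protected def and (P Q : IProp) : IProp :=
  ⟨fun n a => P.holds n a ∧ Q.holds n a, fun h ⟨hP, hQ⟩ => ⟨P.mono h hP, Q.mono h hQ⟩⟩

protected def or (P Q : IProp) : IProp :=
  ⟨fun n a => P.holds n a ∨ Q.holds n a,
    fun h => Or.imp (P.mono h) (Q.mono h)⟩

protected def all {ι : Sort*} (P : ι → IProp) : IProp :=
  ⟨fun n a => ∀ i, (P i).holds n a, fun h hP i => (P i).mono h (hP i)⟩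

protected def ex {ι : Sort*} (P : ι → IProp) : IProp :=
  ⟨fun n a => ∃ i, (P i).holds n a, fun h ⟨i, hP⟩ => ⟨i, (P i).mono h hP⟩⟩

/-- Separating conjunction. -/
def sep (P Q : IProp) : IProp :=
  ⟨fun n a => ∃ a₁ a₂, a = a₁ + a₂ ∧ P.holds n a₁ ∧ Q.holds n a₂, by
    rintro n n' _ c h ⟨a₁, a₂, rfl, hP, hQ⟩
    refine ⟨a₁, a₂ + c, add_assoc .., ?_, Q.mono h hQ⟩
    simpa using P.mono (c := 0) h hP⟩

/-- Separating implication. -/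
def wand (P Q : IProp) : IProp :=
  ⟨fun n a => ∀ n' ≤ n, ∀ b : Res, (a + b).Valid → P.holds n' b → Q.holds n' (a + b), by
    intro n n' a c h hW m hm b hv hP
    rw [add_assoc] at hv ⊢
    refine hW m (hm.trans h) _ hv ?_
    rw [add_comm]
    exact P.mono le_rfl hP⟩

/-- The later modality. -/
def later (P : IProp) : IProp :=
  ⟨fun n a => ∀ m, n = m + 1 → P.holds m a, by
    rintro n n' a c h hP m rfl
    obtain ⟨k, rfl⟩ : ∃ k, n = k + 1 := ⟨n - 1, by omega⟩
    exact P.mono (by omega) (hP k rfl)⟩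

/-- The update modality: `P` holds after a frame-preserving update. -/
def upd (P : IProp) : IProp :=
  ⟨fun n a => ∀ n' ≤ n, ∀ f : Res, (a + f).Valid → ∃ b, (b + f).Valid ∧ P.holds n' b, by
    intro n n' a c h hP m hm f hf
    obtain ⟨b, hb, hPb⟩ := hP m (hm.trans h) (c + f) (by rwa [← add_assoc])
    exact ⟨b + c, by rwa [add_assoc], P.mono le_rfl hPb⟩⟩

/-- Ownership of a resource. -/
def own (r : Res) : IProp :=
  ⟨fun _ a => ∃ c, a = r + c, by
    rintro _ _ _ c - ⟨d, rfl⟩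
    exact ⟨d + c, add_assoc ..⟩⟩

end IProp

open IProp

/-- Ownership of `ε` error credits. -/
def upto (ε : ℝ≥0) : IProp := own (0, (0, 0, 0, 0, 0, ε))

/-- The right-hand side program is `e`. -/
def spec (e : Expr) : IProp := own (0, (0, 0, .own e, 0, 0, 0))

/-- The state interpretation: the authoritative view of the left-hand state, the right-hand
configuration and the error budget. -/
def stateInterp (σ : State) (ρ' : Conf) (ε : ℝ≥0) : IProp :=
  own (.own
    (fun l => .ofOption (σ.heap.lookup l), fun κ => .ofOption (σ.tapes.lookup κ),
      .own ρ'.1,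
      fun l => .ofOption (ρ'.2.heap.lookup l), fun κ => .ofOption (ρ'.2.tapes.lookup κ),
      ε), 0)

/-! ## Coupling preconditions and the weakest precondition -/

/-- The rules of the spec-coupling precondition, with `X` in place of its recursive occurrence. -/
noncomputable def specCouplRules (Φ X : State → Conf → ℝ≥0 → IProp)
    (σ₁ : State) (ρ₁' : Conf) (ε : ℝ≥0) : IProp :=
  IProp.or (pure (1 ≤ ε)) <| IProp.or (Φ σ₁ ρ₁' ε) <|
    IProp.ex fun R : State → Conf → Prop => IProp.ex fun n : ℕ =>
    IProp.ex fun μ₁ : SubDistr State => IProp.ex fun μ₁' : SubDistr State =>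
    IProp.ex fun ε₁ : ℝ≥0 => IProp.ex fun E₂ : Conf → ℝ≥0 =>
      let ν := μ₁'.bind fun σ₂' => pexec n (ρ₁'.1, σ₂')
      IProp.and
        (pure (ARCoupl μ₁ ν ε₁ R ∧ (∀ ρ, E₂ ρ ≤ 1) ∧
          (ε₁ : ℝ≥0∞) + ν.expect (fun ρ => E₂ ρ) ≤ ε ∧
          Erasable μ₁ σ₁ ∧ Erasable μ₁' ρ₁'.2))
        (IProp.all fun σ₂ : State => IProp.all fun ρ₂' : Conf => IProp.all fun _ : R σ₂ ρ₂' =>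
          upd (X σ₂ ρ₂' (E₂ ρ₂')))

/-- The spec-coupling precondition: the least predicate closed under its rules. -/
noncomputable def specCoupl (σ : State) (ρ' : Conf) (ε : ℝ≥0)
    (Φ : State → Conf → ℝ≥0 → IProp) : IProp :=
  IProp.all fun X : State → Conf → ℝ≥0 → IProp =>
    IProp.all fun _ : ∀ σ₁ ρ₁' ε₁, Entails (specCouplRules Φ X σ₁ ρ₁' ε₁) (X σ₁ ρ₁' ε₁) =>
      X σ ρ' ε

/-- The program-coupling precondition: one step on the left, finitely many on the right. -/
noncomputable def progCoupl (ρ₁ ρ₁' : Conf) (ε : ℝ≥0) (Φ : Conf → Conf → ℝ≥0 → IProp) : IProp :=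
  IProp.ex fun R : Conf → Conf → Prop => IProp.ex fun n : ℕ =>
  IProp.ex fun μ₁' : SubDistr State => IProp.ex fun ε₁ : ℝ≥0 =>
  IProp.ex fun E₂ : Conf → ℝ≥0 =>
    IProp.and
      (pure (ARCoupl (step ρ₁.1 ρ₁.2) (μ₁'.bind fun σ₂' => pexec n (ρ₁'.1, σ₂')) ε₁ R ∧
        Reducible ρ₁ ∧ (∀ ρ, E₂ ρ ≤ 1) ∧
        (ε₁ : ℝ≥0∞) + (step ρ₁.1 ρ₁.2).expect (fun ρ => E₂ ρ) ≤ ε ∧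
        Erasable μ₁' ρ₁'.2))
      (IProp.all fun ρ₂ : Conf => IProp.all fun ρ₂' : Conf => IProp.all fun _ : R ρ₂ ρ₂' =>
        upd (Φ ρ₂ ρ₂' (E₂ ρ₂)))

/-- The equation of the weakest precondition, with `W` in place of its recursive occurrence. -/
noncomputable def wpPre (Φ : Val → IProp) (W : Expr → IProp) (e₁ : Expr) : IProp :=
  IProp.all fun σ₁ : State => IProp.all fun ρ₁' : Conf => IProp.all fun ε₁ : ℝ≥0 =>
    wand (stateInterp σ₁ ρ₁' ε₁) <| upd <|
      specCoupl σ₁ ρ₁' ε₁ fun σ₂ ρ₂' ε₂ =>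
        IProp.or
          (IProp.ex fun v : Val => IProp.and (pure (e₁ = .val v)) <|
            upd (sep (stateInterp σ₂ ρ₂' ε₂) (Φ v)))
          (IProp.and (pure (e₁.toVal = none)) <|
            progCoupl (e₁, σ₂) ρ₂' ε₂ fun ρ₃ ρ₃' ε₃ =>
              later <| specCoupl ρ₃.2 ρ₃' ε₃ fun σ₄ ρ₄' ε₄ =>
                upd (sep (stateInterp σ₄ ρ₄' ε₄) (W ρ₃.1)))

/-- The iterates of `wpPre Φ`, starting from truth. -/
noncomputable def wpIter (Φ : Val → IProp) : ℕ → Expr → IProp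
  | 0 => fun _ => pure True
  | k + 1 => wpPre Φ (wpIter Φ k)

/-- The weakest precondition: the fixed point of `wpPre Φ`, as the intersection of the iterates.
Recursive occurrences are guarded by `later`, so at step index `n` the iterates are constant from
the `(n + 1)`-st one on. -/
noncomputable def wp (e : Expr) (Φ : Val → IProp) : IProp :=
  IProp.all fun k : ℕ => wpIter Φ k e

theorem upd_imp {P Q : IProp} {n : ℕ} (h : ∀ m ≤ n, ∀ a, P.holds m a → Q.holds m a) {a : Res}
    (hP : (upd P).holds n a) : (upd Q).holds n a := fun m hm f hf =>
  let ⟨b, hb, hPb⟩ := hP m hm f hf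
  ⟨b, hb, h m hm b hPb⟩

theorem sep_imp {P Q Q' : IProp} {n : ℕ} (h : ∀ a, Q.holds n a → Q'.holds n a) {a : Res}
    (hP : (sep P Q).holds n a) : (sep P Q').holds n a :=
  let ⟨a₁, a₂, ha, h₁, h₂⟩ := hP
  ⟨a₁, a₂, ha, h₁, h a₂ h₂⟩

theorem mono_index {P : IProp} {n m : ℕ} {a : Res} (h : m ≤ n) (hP : P.holds n a) :
    P.holds m a := by
  simpa using P.mono (c := 0) h hP

theorem specCoupl_imp {Φ Φ' : State → Conf → ℝ≥0 → IProp} {n : ℕ}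
    (h : ∀ m ≤ n, ∀ σ ρ ε a, (Φ σ ρ ε).holds m a → (Φ' σ ρ ε).holds m a)
    {σ : State} {ρ : Conf} {ε : ℝ≥0} {a : Res} (hΦ : (specCoupl σ ρ ε Φ).holds n a) :
    (specCoupl σ ρ ε Φ').holds n a := by
  intro X hX
  let X' : State → Conf → ℝ≥0 → IProp := fun σ ρ ε =>
    ⟨fun m a => ∀ k ≤ m, k ≤ n → (X σ ρ ε).holds k a,
      fun hm hx k hk hkn => (X σ ρ ε).mono le_rfl (hx k (hk.trans hm) hkn)⟩
  refine hΦ X' ?_ n le_rfl le_rfl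
  intro σ₁ ρ₁ ε₁ m b hb hr k hk hkn
  refine hX σ₁ ρ₁ ε₁ k b hb ?_
  rcases mono_index hk hr with h₁ | h₂ | ⟨R, j, μ, μ', δ, E, hp, hc⟩
  · exact Or.inl h₁
  · exact Or.inr (Or.inl (h k hkn _ _ _ _ h₂))
  · refine Or.inr (Or.inr ⟨R, j, μ, μ', δ, E, hp, fun σ₂ ρ₂ hR => ?_⟩)
    exact upd_imp (P := X' σ₂ ρ₂ (E ρ₂)) (fun m' hm' c hx => hx m' le_rfl (hm'.trans hkn))
      (hc σ₂ ρ₂ hR)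

theorem wpPre_imp {Φ : Val → IProp} {W W' : Expr → IProp} {n : ℕ}
    (h : ∀ m < n, ∀ e a, (W e).holds m a → (W' e).holds m a) {e : Expr} {a : Res}
    (hW : (wpPre Φ W e).holds n a) : (wpPre Φ W' e).holds n a := by
  intro σ₁ ρ₁ ε₁ m hm b hb hS
  refine upd_imp (fun k hk c hc => specCoupl_imp (fun i hi σ₂ ρ₂ ε₂ d hd => ?_) hc)
    (hW σ₁ ρ₁ ε₁ m hm b hb hS)
  rcases hd with hv | ⟨hnv, R, j, μ', δ, E, hp, hr⟩
  · exact Or.inl hv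
  · refine Or.inr ⟨hnv, R, j, μ', δ, E, hp, fun ρ₃ ρ₃' hR => ?_⟩
    refine upd_imp (fun i' hi' d' hd' l hl => ?_) (hr ρ₃ ρ₃' hR)
    refine specCoupl_imp (fun l' hl' _ _ _ _ hx => ?_) (hd' l hl)
    exact upd_imp (fun l'' hl'' _ => sep_imp fun _ => h l'' (by omega) _ _) hx

theorem wpIter_imp (Φ : Val → IProp) : ∀ (n k k' : ℕ) (e : Expr) (a : Res), n < k →
    (wpIter Φ k e).holds n a → (wpIter Φ k' e).holds n a := by
  intro n
  induction n using Nat.strong_induction_on with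
  | _ n ih =>
    intro k k' e a hk hW
    obtain ⟨i, rfl⟩ : ∃ i, k = i + 1 := ⟨k - 1, by omega⟩
    cases k' with
    | zero => trivial
    | succ j => exact wpPre_imp (fun m hm e a => ih m hm i j e a (by omega)) hW

/-- The weakest precondition solves its equation. -/
theorem wp_unfold (e : Expr) (Φ : Val → IProp) (n : ℕ) (a : Res) :
    (wp e Φ).holds n a ↔ (wpPre Φ (fun e' => wp e' Φ) e).holds n a := by
  constructor
  · intro h
    exact wpPre_imp (fun m hm e' b hb k => wpIter_imp Φ m n k e' b hm hb) (h (n + 1))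
  · intro h k
    cases k with
    | zero => trivial
    | succ j => exact wpPre_imp (W := fun e' => wp e' Φ) (fun m hm e' b hb => hb j) h

/-- The solution is unique. -/
theorem wp_unique (Φ : Val → IProp) (W : Expr → IProp)
    (hW : ∀ e n a, (W e).holds n a ↔ (wpPre Φ W e).holds n a) (n : ℕ) :
    ∀ e a, (W e).holds n a ↔ (wp e Φ).holds n a := by
  induction n using Nat.strong_induction_on with
  | _ n ih =>
    intro e a
    rw [hW, wp_unfold]
    exact ⟨wpPre_imp fun m hm e b => (ih m hm e b).1, wpPre_imp fun m hm e b => (ih m hm e b).2⟩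

/-- The refinement weakest precondition. -/
noncomputable def wpRef (e e' : Expr) (Φ : Val → Val → IProp) : IProp :=
  IProp.all fun K : Ectx =>
    wand (spec (K.fill e')) <|
      wp e fun v => IProp.ex fun v' : Val => sep (spec (K.fill (.val v'))) (Φ v v')

/-! ## Derived syntax -/

/-- Application is written by juxtaposition. -/
instance : CoeFun Expr (fun _ => Expr → Expr) := ⟨Expr.app⟩

instance : Coe Val Expr := ⟨Expr.val⟩

/-- The function value `λ x. e`. -/
def Val.lam (x : ℕ) (e : Expr) : Val := .fix none (some x) e

namespace Expr

/-- The expression `λ x. e`. -/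
def lam (x : ℕ) (e : Expr) : Expr := .fix none (some x) e

/-- The expression `λ _. e`. -/
def thunk (e : Expr) : Expr := .fix none none e

/-- `let x = e₁ in e₂`. -/
def letIn (x : ℕ) (e₁ e₂ : Expr) : Expr := .app (lam x e₂) e₁

/-- `e₁; e₂`. -/
def seq (e₁ e₂ : Expr) : Expr := .app (thunk e₂) e₁

def int (z : ℤ) : Expr := .val (.int z)

def unit : Expr := .val .unit

/-- Allocation of a single cell. -/
def alloc (e : Expr) : Expr := .allocN (int 1) e

/-- The empty option. -/
def optNone : Expr := .inl unit

def optSome (e : Expr) : Expr := .inr e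

/-- The empty list. -/
def nil : Expr := .inl unit

/-- The list with head `e₁` and tail `e₂`. -/
def cons (e₁ e₂ : Expr) : Expr := .inr (.pair e₁ e₂)

/-- The content of an option (and `()` for the empty option). -/
def content (e : Expr) : Expr := .case e (thunk unit) (lam 0 (.var 0))

end Expr

/-! ## Library functions -/

/-! Names of program variables. -/

abbrev xN : ℕ := 0
abbrev xQ : ℕ := 1
abbrev xf : ℕ := 2
abbrev xx : ℕ := 3
abbrev xy : ℕ := 4
abbrev xm : ℕ := 5
abbrev xi : ℕ := 6
abbrev xk : ℕ := 7
abbrev xl : ℕ := 8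
abbrev xp : ℕ := 9
abbrev xlen : ℕ := 10
abbrev xunused : ℕ := 11
abbrev xxys : ℕ := 12
abbrev xrec : ℕ := 13

open ProbLang.Expr

/-- The list of the `n` consecutive integers from `i` on. -/
def listSeq : Val :=
  .fix (some xrec) (some xi) <| lam xN <|
    .ite (.binop .eq (var xN) (int 0)) nil
      (cons (var xi)
        (var xrec (.binop .add (var xi) (int 1)) (.binop .sub (var xN) (int 1))))

def listLength : Val :=
  .fix (some xrec) (some xl) <|
    .case (var xl)
      (thunk (int 0))
      (lam xp (.binop .add (int 1) (var xrec (.snd (var xp)))))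

/-- The `k`-th element of a list, as an option. -/
def listNth : Val :=
  .fix (some xrec) (some xl) <| lam xk <|
    .case (var xl)
      (thunk optNone)
      (lam xp <|
        .ite (.binop .eq (var xk) (int 0)) (optSome (.fst (var xp)))
          (var xrec (.snd (var xp)) (.binop .sub (var xk) (int 1))))

/-- The list without its `k`-th element. -/
def listRemoveNth : Val :=
  .fix (some xrec) (some xl) <| lam xk <|
    .case (var xl)
      (thunk nil)
      (lam xp <|
        .ite (.binop .eq (var xk) (int 0)) (.snd (var xp))
          (cons (.fst (var xp))
            (var xrec (.snd (var xp)) (.binop .sub (var xk) (int 1)))))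

/-- The value of a key in an association list, as an option. -/
def listAssoc : Val :=
  .fix (some xrec) (some xl) <| lam xk <|
    .case (var xl)
      (thunk optNone)
      (lam xp <|
        .ite (.binop .eq (.fst (.fst (var xp))) (var xk)) (optSome (.snd (.fst (var xp))))
          (var xrec (.snd (var xp)) (var xk)))

/-- A new empty map: a reference to an association list. -/
def mapInit : Val := .fix none none (alloc nil)

/-- Look up a key in a map; the result is an option. -/
def mapGet : Val := .lam xm <| lam xk <| (listAssoc : Expr) (.load (var xm)) (var xk)

/-- Set the value of a key in a map. -/
def mapSet : Val :=
  .lam xm <| lam xk <| lam xy <|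
    .store (var xm) (cons (.pair (var xk) (var xy)) (.load (var xm)))

/-! ## Random functions, random permutations and the weak adversary -/

/-- The idealized random function on `{0, …, N - 1}`. -/
def rfImpl : Val :=
  .lam xN <|
    letIn xm ((mapInit : Expr) unit) <|
    lam xx <|
      seq
        (.ite (.binop .eq ((mapGet : Expr) (var xm) (var xx)) optNone)
          (letIn xy (.rand (.binop .sub (var xN) (int 1))) <|
            (mapSet : Expr) (var xm) (var xx) (var xy))
          unit)
        (content ((mapGet : Expr) (var xm) (var xx)))

/-- The idealized random permutation of `{0, …, N - 1}`. -/
def rpImpl : Val :=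
  .lam xN <|
    letIn xm ((mapInit : Expr) unit) <|
    letIn xunused (alloc ((listSeq : Expr) (int 0) (var xN))) <|
    lam xx <|
      seq
        (.ite (.binop .eq ((mapGet : Expr) (var xm) (var xx)) optNone)
          (letIn xlen ((listLength : Expr) (.load (var xunused))) <|
            letIn xk (.rand (.binop .sub (var xlen) (int 1))) <|
            letIn xy (content ((listNth : Expr) (.load (var xunused)) (var xk))) <|
            seq ((mapSet : Expr) (var xm) (var xx) (var xy)) <|
              .store (var xunused) ((listRemoveNth : Expr) (.load (var xunused)) (var xk)))
          unit)
        (content ((mapGet : Expr) (var xm) (var xx)))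

/-- The weak adversary: it queries `f` at `Q` uniformly random points of `{0, …, N - 1}` and
returns the list of all query-answer pairs, the latest one first. -/
def weakAdv : Val :=
  .lam xN <| lam xQ <| lam xf <|
    letIn xxys (alloc nil) <|
    seq
      ((Expr.fix (some xrec) (some xi) <|
          .ite (.binop .lt (var xi) (var xQ))
            (seq
              (letIn xx (.rand (.binop .sub (var xN) (int 1))) <|
                letIn xy (var xf (var xx)) <|
                .store (var xxys) (cons (.pair (var xx) (var xy)) (.load (var xxys))))
              (var xrec (.binop .add (var xi) (int 1))))
            unit)
        (int 0))
      (.load (var xxys))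

/-- The weak adversary with `Q` queries, run against the random function on `N` elements. -/
def advRF (N Q : ℕ) : Expr := (weakAdv : Expr) (int N) (int Q) ((rfImpl : Expr) (int N))

/-- The weak adversary with `Q` queries, run against the random permutation of `N` elements. -/
def advRP (N Q : ℕ) : Expr := (weakAdv : Expr) (int N) (int Q) ((rpImpl : Expr) (int N))

/-- The error bound `Q (Q - 1) / (2 N)`. -/
noncomputable def errBound (N Q : ℕ) : ℝ≥0 :=
  ⟨(Q : ℝ) * ((Q : ℝ) - 1) / (2 * (N : ℝ)), by
    refine div_nonneg ?_ (by positivity)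
    rcases Nat.eq_zero_or_pos Q with rfl | h
    · simp
    · have : (1 : ℝ) ≤ Q := by exact_mod_cast h
      exact mul_nonneg (by linarith) (by linarith)⟩

end ProbLang

/-!
Both parts of the theorem follow from one statement about the operational semantics, the relation
`Coupled`: an inductive description of how two programs are run side by side to equal values, by
deterministic steps on either side and by couplings of a `rand` on one side with a `rand` on the
other. Each coupling has an error, and the errors along every path are bounded by the index of the
relation. Since the derivation is well-founded, there is no need for guarded recursion, and since
couplings are required in both directions, the relation is symmetric.

* `Coupled.exec_le`: the probabilities of reaching a value differ by at most the error. At a `rand`,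
  the probability is an expected value over the outcomes, to which the coupling applies.
* `Coupled.wp`: the error, paid for in credits, gives the weakest precondition. A step on the left
  uses the program coupling with no step on the right, a step on the right the spec coupling with
  the Dirac distribution, and a coupled sampling the program coupling with one step on the right.
  The partial heaps of `Coupled` are owned, so that they are stable under frames.

It remains to couple the adversary run against the permutation with the adversary run against the
function (`coupled_advRP_advRF`). The adversary's own samplings are coupled by equality. The two
maps stay equal (`QueryInv`), so a repeated query costs nothing. At a fresh query with `s` keys in
the map, the list of unused values has length `N - s`; the sampled position is coupled with the
function's sample if the latter is the value at that position. This is a coupling of uniform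
distributions along an injection (`arcoupl_unif_injective`, `arcoupl_unif_injective_symm`), and its
error in both directions is the proportion `s / N` of missed values. Before the `j`-th query,
counted from `0`, there are at most `j` keys, so the total is at most `∑ j < Q, j / N`, which is
`Q (Q - 1) / (2 N)` (`credits_zero`).

The deterministic parts of the programs are executed by a big-step calculus for the relation
`RunsTo`; the library functions on lists and maps are proved correct in it by induction.
-/

namespace ProbLang

/-! ### Subdistributions -/

namespace SubDistr

variable {A B C : Type}

theorem ext_mass {μ ν : SubDistr A} (h : ∀ a, μ a = ν a) : μ = ν := by
  cases μ; cases ν; congr 1; exact funext h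

theorem bind_apply (μ : SubDistr A) (f : A → SubDistr B) (b : B) :
    μ.bind f b = μ.expect fun a => f a b := rfl

@[simp]
theorem expect_ret (a : A) (X : A → ℝ≥0∞) : (ret a).expect X = X a := by
  classical
  simp [expect, ret]

@[simp]
theorem expect_bind (μ : SubDistr A) (f : A → SubDistr B) (X : B → ℝ≥0∞) :
    (μ.bind f).expect X = μ.expect fun a => (f a).expect X := by
  simp only [expect, bind, ← ENNReal.tsum_mul_right, ← ENNReal.tsum_mul_left]
  rw [ENNReal.tsum_comm]
  simp only [mul_assoc]

@[simp]
theorem expect_map (f : A → B) (μ : SubDistr A) (X : B → ℝ≥0∞) :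
    (μ.map f).expect X = μ.expect fun a => X (f a) := by
  simp [map]

theorem expect_unif (N : ℕ) (X : Fin (N + 1) → ℝ≥0∞) :
    (unif N).expect X = ((N : ℝ≥0∞) + 1)⁻¹ * ∑ k, X k := by
  simp [expect, unif, tsum_fintype, Finset.mul_sum]

theorem expect_mono (μ : SubDistr A) {X Y : A → ℝ≥0∞} (h : ∀ a, X a ≤ Y a) :
    μ.expect X ≤ μ.expect Y :=
  ENNReal.tsum_le_tsum fun a => mul_le_mul_right (h a) _

theorem expect_const_le (μ : SubDistr A) (c : ℝ≥0∞) : μ.expect (fun _ => c) ≤ c := by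
  rw [expect, ENNReal.tsum_mul_right]
  exact mul_le_of_le_one_left' μ.sum_le_one

theorem expect_add (μ : SubDistr A) (X Y : A → ℝ≥0∞) :
    μ.expect (fun a => X a + Y a) = μ.expect X + μ.expect Y := by
  simp only [expect, mul_add, ENNReal.tsum_add]

@[simp]
theorem ret_bind (a : A) (f : A → SubDistr B) : (ret a).bind f = f a :=
  ext_mass fun b => by rw [bind_apply, expect_ret]

@[simp]
theorem map_ret (f : A → B) (a : A) : (ret a).map f = ret (f a) := ret_bind ..

@[simp]
theorem bind_ret (μ : SubDistr A) : μ.bind ret = μ :=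
  ext_mass fun b => by
    classical
    rw [bind_apply, expect, tsum_eq_single b]
    · simp [ret]
    · intro a ha
      simp [ret, ha.symm]

theorem bind_assoc (μ : SubDistr A) (f : A → SubDistr B) (g : B → SubDistr C) :
    (μ.bind f).bind g = μ.bind fun a => (f a).bind g :=
  ext_mass fun c => by simp only [bind_apply, expect_bind]

theorem map_map (f : A → B) (g : B → C) (μ : SubDistr A) :
    (μ.map f).map g = μ.map fun a => g (f a) := by
  simp only [map, bind_assoc, ret_bind]

@[simp]
theorem map_bind (f : A → B) (g : B → SubDistr C) (μ : SubDistr A) :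
    (μ.map f).bind g = μ.bind fun a => g (f a) := by
  simp only [map, bind_assoc, ret_bind]

theorem unif_apply_pos (N : ℕ) (k : Fin (N + 1)) : 0 < unif N k := by
  simp [unif]

theorem ret_apply_self (a : A) : ret a a = 1 := by
  simp [ret]

theorem map_apply_pos (f : A → B) {μ : SubDistr A} {a : A} (h : 0 < μ a) :
    0 < μ.map f (f a) := by
  refine lt_of_lt_of_le ?_ (ENNReal.le_tsum a)
  simpa [ret_apply_self] using h

end SubDistr

open SubDistr

theorem ARCoupl.ret {A B : Type} {R : A → B → Prop} {a : A} {b : B} (h : R a b) :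
    ARCoupl (ret a) (ret b) 0 R := fun X Y _ _ hXY => by
  simpa using hXY a b h

theorem ARCoupl.map {A B C D : Type} {μ : SubDistr A} {ν : SubDistr B} {ε : ℝ≥0}
    {R : A → B → Prop} {S : C → D → Prop} {f : A → C} {g : B → D} (h : ARCoupl μ ν ε R)
    (hS : ∀ a b, R a b → S (f a) (g b)) : ARCoupl (μ.map f) (ν.map g) ε S :=
  fun X Y hX hY hXY => by
    simpa using h (fun a => X (f a)) (fun b => Y (g b)) (fun _ => hX _) (fun _ => hY _)
      fun a b hab => hXY _ _ (hS a b hab)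

/-! ### Couplings of uniform distributions along an injection -/

theorem sum_comp_le_of_injective {ι κ : Type} [Fintype ι] [Fintype κ] {g : ι → κ}
    (hg : Function.Injective g) (Y : κ → ℝ≥0∞) : ∑ k, Y (g k) ≤ ∑ j, Y j := by
  classical
  rw [← Finset.sum_image (f := Y) (s := Finset.univ) (g := g) fun a _ b _ h => hg h]
  exact Finset.sum_le_sum_of_subset (Finset.subset_univ _)

theorem sum_le_sum_comp_add {ι κ : Type} [Fintype ι] [Fintype κ] {g : ι → κ}
    (hg : Function.Injective g) {X : κ → ℝ≥0∞} (hX : ∀ j, X j ≤ 1) :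
    ∑ j, X j ≤ ∑ k, X (g k) + ((Fintype.card κ - Fintype.card ι : ℕ) : ℝ≥0∞) := by
  classical
  rw [← Finset.sum_image (f := X) (s := Finset.univ) (g := g) fun a _ b _ h => hg h,
    ← Finset.sum_add_sum_compl (Finset.univ.image g) X]
  gcongr
  calc ∑ j ∈ (Finset.univ.image g)ᶜ, X j ≤ ∑ j ∈ (Finset.univ.image g)ᶜ, 1 :=
        Finset.sum_le_sum fun j _ => hX j
    _ = _ := by
        rw [Finset.sum_const, nsmul_one, Finset.card_compl, Finset.card_image_of_injective _ hg,
          Finset.card_univ]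

/-- The coupling of a uniform index with a uniform value: the indices fill only a fraction
`(c + 1) / (n + 1)` of the target, and the missing mass `(n - c) / (n + 1)` is the error. -/
theorem arcoupl_unif_injective {c n : ℕ} {g : Fin (c + 1) → Fin (n + 1)}
    (hg : Function.Injective g) :
    ARCoupl (unif c) (unif n) (((n - c : ℕ) : ℝ≥0) / ((n + 1 : ℕ) : ℝ≥0))
      fun k j => g k = j := by
  intro X Y hX hY hXY
  have hcn : c ≤ n := by simpa using Fintype.card_le_of_injective g hg
  have h1 : ∑ k, X k ≤ ∑ j, Y j :=
    (Finset.sum_le_sum fun k _ => hXY k _ rfl).trans (sum_comp_le_of_injective hg Y)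
  have h2 : ∑ k, X k ≤ ((c + 1 : ℕ) : ℝ≥0∞) := by
    simpa using Finset.sum_le_sum fun k (_ : k ∈ Finset.univ) => hX k
  rw [expect_unif, expect_unif]
  refine le_trans ?_ (add_le_add_left (mul_le_mul_right h1 _) _)
  lift ∑ k, X k to ℝ≥0 using ne_top_of_le_ne_top (by simp) h2 with S
  have h2' : (S : ℝ) ≤ c + 1 := by exact_mod_cast h2
  have e1 : ((c : ℝ≥0∞) + 1)⁻¹ * S = (((c + 1 : ℝ≥0)⁻¹ * S : ℝ≥0) : ℝ≥0∞) := by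
    rw [ENNReal.coe_mul, ENNReal.coe_inv (by positivity)]; simp
  have e2 : ((n : ℝ≥0∞) + 1)⁻¹ * S = (((n + 1 : ℝ≥0)⁻¹ * S : ℝ≥0) : ℝ≥0∞) := by
    rw [ENNReal.coe_mul, ENNReal.coe_inv (by positivity)]; simp
  rw [e1, e2]
  norm_cast
  rw [← NNReal.coe_le_coe]
  have hcn' : (c : ℝ) ≤ n := by exact_mod_cast hcn
  have hsub : (((n : ℝ≥0) - c : ℝ≥0) : ℝ) = n - c :=
    NNReal.coe_sub (by exact_mod_cast hcn)
  push_cast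
  rw [hsub]
  have : ((n : ℝ) + 1)⁻¹ * S + (n - c) / (n + 1) - ((c : ℝ) + 1)⁻¹ * S
      = (n - c) * (c + 1 - S) / ((c + 1) * (n + 1)) := by
    field_simp
    ring
  have h3 : 0 ≤ (n - c) * (c + 1 - (S : ℝ)) / (((c : ℝ) + 1) * (n + 1)) :=
    div_nonneg (mul_nonneg (by linarith) (by linarith)) (by positivity)
  linarith

/-- The coupling of `arcoupl_unif_injective` in the other direction: the error is the
probability that the sample misses the range of `g`. -/
theorem arcoupl_unif_injective_symm {c n : ℕ} {g : Fin (c + 1) → Fin (n + 1)}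
    (hg : Function.Injective g) :
    ARCoupl (unif n) (unif c) (((n - c : ℕ) : ℝ≥0) / ((n + 1 : ℕ) : ℝ≥0))
      fun j k => g k = j := by
  intro X Y hX hY hXY
  have hcn : c ≤ n := by simpa using Fintype.card_le_of_injective g hg
  rw [expect_unif, expect_unif]
  have h1 : ∑ j, X j ≤ ∑ k, Y k + ((n - c : ℕ) : ℝ≥0∞) := by
    refine (sum_le_sum_comp_add hg hX).trans ?_
    simp only [Fintype.card_fin, Nat.add_sub_add_right]
    gcongr with k
    exact hXY _ k rfl
  calc _ ≤ ((n : ℝ≥0∞) + 1)⁻¹ * (∑ k, Y k + ((n - c : ℕ) : ℝ≥0∞)) := by gcongr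
    _ = ((n : ℝ≥0∞) + 1)⁻¹ * ∑ k, Y k + ((n : ℝ≥0∞) + 1)⁻¹ * ((n - c : ℕ) : ℝ≥0∞) := mul_add ..
    _ ≤ _ := by
      gcongr
      rw [ENNReal.coe_div (by positivity), ENNReal.div_eq_inv_mul]
      push_cast
      rfl

/-! ### Reduction under evaluation contexts -/

theorem step_of_decomp_eq_none {e : Expr} (h : e.decomp = none) (σ : State) :
    step e σ = headStep e σ := by
  rw [step]
  split
  · simp_all
  · rfl

theorem step_of_decomp_eq_some {e e' : Expr} {F : Frame} (h : e.decomp = some (F, e'))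
    (σ : State) : step e σ = (step e' σ).map fun ρ => (F.fill ρ.1, ρ.2) := by
  rw [step]
  split
  · rename_i h'
    rw [h] at h'
    cases h'
    rfl
  · simp_all

theorem Frame.decomp_fill (F : Frame) {e : Expr} (h : e.toVal = none) :
    (F.fill e).decomp = some (F, e) := by
  cases F <;> simp [Frame.fill, Expr.decomp, focus, h] <;> simp [Expr.toVal]

theorem Frame.toVal_fill (F : Frame) (e : Expr) : (F.fill e).toVal = none := by
  cases F <;> rfl

theorem Frame.step_fill (F : Frame) {e : Expr} (h : e.toVal = none) (σ : State) :
    step (F.fill e) σ = (step e σ).map fun ρ => (F.fill ρ.1, ρ.2) :=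
  step_of_decomp_eq_some (F.decomp_fill h) σ

theorem Ectx.toVal_fill (K : Ectx) {e : Expr} (h : e.toVal = none) : (K.fill e).toVal = none := by
  cases K with
  | nil => exact h
  | cons F K => exact F.toVal_fill _

theorem Ectx.step_fill (K : Ectx) {e : Expr} (h : e.toVal = none) (σ : State) :
    step (K.fill e) σ = (step e σ).map fun ρ => (K.fill ρ.1, ρ.2) := by
  induction K with
  | nil => exact (bind_ret _).symm
  | cons F K ih =>
    change step (F.fill (Ectx.fill K e)) σ = _
    rw [F.step_fill (Ectx.toVal_fill K h), ih, map_map]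
    rfl

theorem Ectx.fill_append (K K' : Ectx) (e : Expr) :
    Ectx.fill (K ++ K') e = Ectx.fill K (Ectx.fill K' e) :=
  List.foldr_append

theorem step_rand (K : Ectx) (N : ℕ) (σ : State) :
    step (K.fill (.rand (.val (.int N)))) σ =
      (unif N).map fun k : Fin (N + 1) => (K.fill (.val (.int (k : ℕ))), σ) := by
  rw [K.step_fill rfl, step_of_decomp_eq_none rfl]
  simp [headStep, unifStep, map_map]

/-! ### Executions -/

theorem execN_val (n : ℕ) (v : Val) (σ : State) : execN n (.val v, σ) = ret v := by
  cases n <;> rfl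

theorem execN_succ {e : Expr} (h : e.toVal = none) (n : ℕ) (σ : State) :
    execN (n + 1) (e, σ) = (step e σ).bind (execN n) := by
  rw [execN, h]

theorem execN_zero {e : Expr} (h : e.toVal = none) (σ : State) : execN 0 (e, σ) = zero := by
  rw [execN, h]

theorem execN_mono_succ (n : ℕ) : ∀ (ρ : Conf) (v : Val), execN n ρ v ≤ execN (n + 1) ρ v := by
  induction n with
  | zero =>
    rintro ⟨e, σ⟩ v
    cases h : e.toVal with
    | none => rw [execN_zero h]; exact zero_le
    | some w => simp [execN, h]
  | succ n ih =>
    rintro ⟨e, σ⟩ v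
    cases h : e.toVal with
    | none =>
      rw [execN_succ h, execN_succ h, bind_apply, bind_apply]
      exact expect_mono _ fun ρ => ih ρ v
    | some w => simp [execN, h]

theorem execN_monotone (ρ : Conf) (v : Val) : Monotone fun n => execN n ρ v :=
  monotone_nat_of_le_succ fun n => execN_mono_succ n ρ v

theorem execN_le_exec (n : ℕ) (ρ : Conf) (v : Val) : execN n ρ v ≤ exec ρ v :=
  le_iSup (fun n => execN n ρ v) n

theorem exec_of_step_ret {e : Expr} {σ : State} {ρ : Conf} (he : e.toVal = none)
    (h : step e σ = ret ρ) (v : Val) : exec (e, σ) v = exec ρ v := by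
  apply le_antisymm
  · refine iSup_le fun n => ?_
    cases n with
    | zero => rw [execN_zero he]; exact zero_le
    | succ n => rw [execN_succ he, h, ret_bind]; exact execN_le_exec ..
  · refine iSup_le fun n => ?_
    have := execN_le_exec (n + 1) (e, σ) v
    rwa [execN_succ he, h, ret_bind] at this

/-- The limit commutes with the expected value, since the executions increase with `n`. -/
theorem exec_of_step_unif {e : Expr} {σ : State} {N : ℕ} {f : Fin (N + 1) → Conf}
    (he : e.toVal = none) (h : step e σ = (unif N).map f) (v : Val) :
    exec (e, σ) v = (unif N).expect fun k => exec (f k) v := by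
  have hsup : (unif N).expect (fun k => exec (f k) v)
      = ⨆ n, (unif N).expect fun k => execN n (f k) v := by
    simp only [expect_unif, exec]
    rw [ENNReal.finsetSum_iSup_of_monotone fun k => execN_monotone (f k) v, ENNReal.mul_iSup]
  rw [hsup]
  have hn (n : ℕ) : execN (n + 1) (e, σ) v = (unif N).expect fun k => execN n (f k) v := by
    rw [execN_succ he, h, map_bind, bind_apply]
  apply le_antisymm
  · refine iSup_le fun n => ?_
    cases n with
    | zero => rw [execN_zero he]; exact zero_le
    | succ n => rw [hn]; exact le_iSup (fun n => (unif N).expect fun k => execN n (f k) v) n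
  · exact iSup_le fun n => (hn n).symm.trans_le (execN_le_exec ..)

/-! ### Partial heaps -/

/-- A partial heap: knowledge of the contents of some locations. -/
abbrev PHeap : Type := Loc → Option Val

/-- The heap `H` agrees with the partial heap `h`. -/
def PHeap.Sub (h : PHeap) (H : Finmap fun _ : Loc => Val) : Prop :=
  ∀ l v, h l = some v → H.lookup l = some v

/-- Replacing the heap `H` by `H₂` and the knowledge `h` by `h₂` preserves all knowledge that is
compatible with `h`: a location changes only if `h` knows everything about it, including that it
is unallocated. -/
def HeapUpd (h : PHeap) (H : Finmap fun _ : Loc => Val) (h₂ : PHeap)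
    (H₂ : Finmap fun _ : Loc => Val) : Prop :=
  ∀ l, (h₂ l = h l ∧ H₂.lookup l = H.lookup l) ∨ (h l = H.lookup l ∧ h₂ l = H₂.lookup l)

theorem HeapUpd.refl (h : PHeap) (H : Finmap fun _ : Loc => Val) : HeapUpd h H h H :=
  fun _ => Or.inl ⟨rfl, rfl⟩

theorem HeapUpd.sub {h h₂ : PHeap} {H H₂ : Finmap fun _ : Loc => Val} (hu : HeapUpd h H h₂ H₂)
    (hs : h.Sub H) : h₂.Sub H₂ := fun l v hl => by
  rcases hu l with ⟨h1, h2⟩ | ⟨-, h2⟩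
  · rw [h2]; exact hs l v (h1 ▸ hl)
  · rw [← h2]; exact hl

theorem HeapUpd.insert {h : PHeap} {H : Finmap fun _ : Loc => Val} {l : Loc}
    (hl : h l = H.lookup l) (v : Val) : HeapUpd h H (Function.update h l (some v)) (H.insert l v) :=
  fun l' => by
    rcases eq_or_ne l' l with rfl | hne
    · exact Or.inr ⟨hl, by simp⟩
    · exact Or.inl ⟨by simp [hne], Finmap.lookup_insert_of_ne _ hne⟩

theorem PHeap.Sub.lookup_eq {h : PHeap} {H : Finmap fun _ : Loc => Val} (hs : h.Sub H) {l : Loc}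
    {v : Val} (hl : h l = some v) : h l = H.lookup l := by
  rw [hl, hs l v hl]

theorem lookup_freshLoc (H : Finmap fun _ : Loc => Val) : H.lookup (freshLoc H) = none := by
  rw [Finmap.lookup_eq_none, ← Finmap.mem_keys]
  intro hm
  have : freshLoc H + 1 ≤ freshLoc H := by
    conv_rhs => rw [freshLoc]
    rw [Finset.le_fold_max]
    exact Or.inr ⟨_, hm, le_rfl⟩
  exact lt_irrefl _ (Int.add_one_le_iff.1 this)

/-! ### Approximately coupled programs -/

/-- From every state that agrees with `h`, the expression `e` makes a deterministic step that
leaves the tapes alone; its result `e₂` and the new knowledge `h₂` may depend on the state, as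
they do for an allocation. -/
def StepsTo (e : Expr) (h : PHeap) (e₂ : State → Expr) (h₂ : State → PHeap) : Prop :=
  e.toVal = none ∧ ∀ σ : State, h.Sub σ.heap → ∃ H₂, step e σ = ret (e₂ σ, ⟨H₂, σ.tapes⟩) ∧
    HeapUpd h σ.heap (h₂ σ) H₂

/-- `Coupled e h e' h' ε`: the programs `e` and `e'`, started in states that agree with `h` and
`h'`, can be run to equal values by deterministic steps on either side and coupled uniform
samplings, the errors of which sum up to at most `ε` on every path. All couplings are required in
both directions, so that the relation is symmetric. -/
inductive Coupled : Expr → PHeap → Expr → PHeap → ℝ≥0 → Prop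
  | val (v : Val) (h h' : PHeap) (ε : ℝ≥0) : Coupled (.val v) h (.val v) h' ε
  | left {e e' : Expr} {h h' : PHeap} {ε : ℝ≥0} {e₂ : State → Expr} {h₂ : State → PHeap} :
      StepsTo e h e₂ h₂ → (∀ σ : State, h.Sub σ.heap → Coupled (e₂ σ) (h₂ σ) e' h' ε) →
      Coupled e h e' h' ε
  | right {e e' : Expr} {h h' : PHeap} {ε : ℝ≥0} {e₂ : State → Expr} {h₂ : State → PHeap} :
      StepsTo e' h' e₂ h₂ → (∀ σ : State, h'.Sub σ.heap → Coupled e h (e₂ σ) (h₂ σ) ε) →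
      Coupled e h e' h' ε
  | rand {h h' : PHeap} {ε ε₁ δ : ℝ≥0} {M M' : ℕ} (K K' : Ectx)
      {R : Fin (M + 1) → Fin (M' + 1) → Prop} :
      ARCoupl (unif M) (unif M') ε₁ R → ARCoupl (unif M') (unif M) ε₁ (fun j k => R k j) →
      ε₁ + δ ≤ ε →
      (∀ k j, R k j →
        Coupled (K.fill (.val (.int (k : ℕ)))) h (K'.fill (.val (.int (j : ℕ)))) h' δ) →
      Coupled (K.fill (.rand (.val (.int M)))) h (K'.fill (.rand (.val (.int M')))) h' ε

theorem Coupled.symm {e e' : Expr} {h h' : PHeap} {ε : ℝ≥0} (H : Coupled e h e' h' ε) :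
    Coupled e' h' e h ε := by
  induction H with
  | val v h h' ε => exact .val v h' h ε
  | left hs _ ih => exact .right hs ih
  | right hs _ ih => exact .left hs ih
  | rand K K' h₁ h₂ hε _ ih => exact .rand K' K h₂ h₁ hε fun j k hjk => ih k j hjk

theorem Coupled.mono {e e' : Expr} {h h' : PHeap} {ε ε' : ℝ≥0} (H : Coupled e h e' h' ε)
    (hε : ε ≤ ε') : Coupled e h e' h' ε' := by
  induction H with
  | val v h h' ε => exact .val v h h' ε'
  | left hs _ ih => exact .left hs fun σ hσ => ih σ hσ hε
  | right hs _ ih => exact .right hs fun σ hσ => ih σ hσ hε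
  | rand K K' h₁ h₂ hδ hc _ => exact .rand K K' h₁ h₂ (hδ.trans hε) hc

/-- Coupled programs reach every value with the same probability, up to the error. -/
theorem Coupled.exec_le {e e' : Expr} {h h' : PHeap} {ε : ℝ≥0} (H : Coupled e h e' h' ε) :
    ∀ (σ σ' : State), h.Sub σ.heap → h'.Sub σ'.heap → ∀ v,
      exec (e, σ) v ≤ exec (e', σ') v + ε := by
  induction H with
  | val w h h' ε =>
    intro σ σ' _ _ v
    simp [exec, execN_val]
  | left hs _ ih =>
    intro σ σ' hσ hσ' v
    obtain ⟨H₂, hst, hu⟩ := hs.2 σ hσ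
    rw [exec_of_step_ret hs.1 hst]
    exact ih σ hσ _ _ (hu.sub hσ) hσ' v
  | right hs _ ih =>
    intro σ σ' hσ hσ' v
    obtain ⟨H₂, hst, hu⟩ := hs.2 σ' hσ'
    rw [exec_of_step_ret hs.1 hst]
    exact ih σ' hσ' _ _ hσ (hu.sub hσ') v
  | @rand h h' ε ε₁ δ M M' K K' R h₁ h₂ hε _ ih =>
    intro σ σ' hσ hσ' v
    rw [exec_of_step_unif (K.toVal_fill rfl) (step_rand K M σ),
      exec_of_step_unif (K'.toVal_fill rfl) (step_rand K' M' σ')]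
    -- The credits `δ` left after the sampling are subtracted first, which makes `X` and `Y`
    -- pointwise comparable on `R`.
    set X : Fin (M + 1) → ℝ≥0∞ := fun k => exec (K.fill (.val (.int (k : ℕ))), σ) v
    set Y : Fin (M' + 1) → ℝ≥0∞ := fun j => exec (K'.fill (.val (.int (j : ℕ))), σ') v
    calc (unif M).expect X
        ≤ (unif M).expect fun k => (X k - δ) + δ := expect_mono _ fun k => le_tsub_add
      _ = (unif M).expect (fun k => X k - δ) + (unif M).expect fun _ => (δ : ℝ≥0∞) :=
          expect_add ..
      _ ≤ ((unif M').expect Y + ε₁) + δ := by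
          gcongr
          · exact h₁ _ _ (fun k => tsub_le_self.trans (exec_le_one ..)) (fun j => exec_le_one ..)
              fun k j hkj => tsub_le_iff_right.2 (ih k j hkj σ σ' hσ hσ' v)
          · exact expect_const_le ..
      _ ≤ (unif M').expect Y + ε := by
          rw [add_assoc]
          gcongr
          exact_mod_cast hε

theorem Coupled.abs_exec_sub_le {e e' : Expr} {h h' : PHeap} {ε : ℝ≥0}
    (H : Coupled e h e' h' ε) {σ σ' : State} (hσ : h.Sub σ.heap) (hσ' : h'.Sub σ'.heap)
    (v : Val) : |(exec (e, σ) v).toReal - (exec (e', σ') v).toReal| ≤ ε := by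
  have key : ∀ {a b : ℝ≥0∞}, b ≤ 1 → a ≤ b + ε → a.toReal ≤ b.toReal + ε := by
    intro a b hb hab
    have hb' : b ≠ ∞ := ne_top_of_le_ne_top ENNReal.one_ne_top hb
    have := ENNReal.toReal_mono (by finiteness) hab
    rwa [ENNReal.toReal_add hb' ENNReal.coe_ne_top, ENNReal.coe_toReal] at this
  rw [abs_sub_le_iff]
  have h₁ := key (exec_le_one ..) (H.exec_le σ σ' hσ hσ' v)
  have h₂ := key (exec_le_one ..) (H.symm.exec_le σ' σ hσ' hσ v)
  constructor <;> linarith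

/-! ### Ownership of partial heaps -/

/-- Ownership of the left heap `h`, the right program `e'`, the right heap `h'` and `ε` credits. -/
def owned (h : PHeap) (e' : Expr) (h' : PHeap) (ε : ℝ≥0) : Res :=
  (0, (fun l => .ofOption (h l), 0, .own e', fun l => .ofOption (h' l), 0, ε))

/-- The resource whose ownership is the state interpretation. -/
def authState (σ : State) (ρ' : Conf) (ε : ℝ≥0) : Res :=
  (.own
    (fun l => .ofOption (σ.heap.lookup l), fun κ => .ofOption (σ.tapes.lookup κ),
      .own ρ'.1,
      fun l => .ofOption (ρ'.2.heap.lookup l), fun κ => .ofOption (ρ'.2.tapes.lookup κ),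
      ε), 0)

theorem Ex.own_add_eq_own {X : Type} {x y : X} {a : Ex X} (h : Ex.own x + a = .own y) :
    a = 0 ∧ x = y := by
  cases a
  · exact ⟨rfl, by simpa using (show Ex.own x = Ex.own y from h)⟩
  · exact absurd (show (Ex.bot : Ex X) = Ex.own y from h) (by simp)
  · exact absurd (show (Ex.bot : Ex X) = Ex.own y from h) (by simp)

theorem Ex.ofOption_ne_bot {X : Type} (o : Option X) : Ex.ofOption o ≠ .bot := by
  cases o <;> simp [Ex.ofOption]

theorem Ex.ofOption_add_self {X : Type} {o : Option X} {a : Ex X}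
    (h : Ex.ofOption o = Ex.ofOption o + a) : a = 0 := by
  cases o with
  | none => rw [← zero_add a]; exact h.symm
  | some x => exact (Ex.own_add_eq_own h.symm).1

theorem Ex.ofOption_eq_some {X : Type} {o : Option X} {x : X} {a : Ex X}
    (h : Ex.ofOption o = Ex.ofOption (some x) + a) : o = some x := by
  cases o with
  | none => cases a <;> exact absurd h (by rintro ⟨⟩)
  | some y => rw [(Ex.own_add_eq_own h.symm).2]

theorem HeapUpd.frame {h h₂ : PHeap} {H H₂ : Finmap fun _ : Loc => Val}
    (hu : HeapUpd h H h₂ H₂) {x : Loc → Ex Val}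
    (hx : (fun l => Ex.ofOption (H.lookup l)) = (fun l => Ex.ofOption (h l)) + x) :
    (fun l => Ex.ofOption (H₂.lookup l)) = (fun l => Ex.ofOption (h₂ l)) + x := by
  funext l
  have hl := congrFun hx l
  simp only [Pi.add_apply] at hl ⊢
  rcases hu l with ⟨h1, h2⟩ | ⟨h1, h2⟩
  · rw [h1, h2, hl]
  · rw [← h1] at hl
    rw [Ex.ofOption_add_self hl, h2, add_zero]

/-- A valid composition with an authoritative element splits that element into the owned part and
the remaining fragments. -/
theorem valid_owned_add_iff {h h' : PHeap} {e' e'' : Expr} {ε ε₁ : ℝ≥0} {σ σ' : State} {c : Res} :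
    (owned h e' h' ε + authState σ (e'', σ') ε₁ + c).Valid ↔
      c.1 = 0 ∧ ε₁ < 1 ∧ ∃ x : Frag,
        (fun l => Ex.ofOption (σ.heap.lookup l)) = (fun l => Ex.ofOption (h l)) + (c.2 + x).1 ∧
        (fun κ => Ex.ofOption (σ.tapes.lookup κ)) = (c.2 + x).2.1 ∧
        Ex.own e'' = Ex.own e' + (c.2 + x).2.2.1 ∧
        (fun l => Ex.ofOption (σ'.heap.lookup l))
          = (fun l => Ex.ofOption (h' l)) + (c.2 + x).2.2.2.1 ∧
        (fun κ => Ex.ofOption (σ'.tapes.lookup κ)) = (c.2 + x).2.2.2.2.1 ∧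
        ε₁ = ε + (c.2 + x).2.2.2.2.2 := by
  obtain ⟨c₁, c₂⟩ := c
  cases c₁ with
  | unit =>
    change ((∃ x : Frag, _ = (owned h e' h' ε).2 + 0 + c₂ + x) ∧ Frag.Valid _) ↔ _
    simp only [add_zero, add_assoc, owned]
    constructor
    · rintro ⟨⟨x, hx⟩, -, -, -, -, -, hlt⟩
      simp only [Prod.ext_iff, Prod.fst_add, Prod.snd_add, zero_add] at hx
      exact ⟨rfl, hlt, x, hx⟩
    · rintro ⟨-, hlt, x, hx⟩
      refine ⟨⟨x, ?_⟩, fun _ => Ex.ofOption_ne_bot _, fun _ => Ex.ofOption_ne_bot _,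
        by simp, fun _ => Ex.ofOption_ne_bot _, fun _ => Ex.ofOption_ne_bot _, hlt⟩
      simp only [Prod.ext_iff, Prod.fst_add, Prod.snd_add, zero_add]
      exact hx
  | own a => exact ⟨fun hv => hv.elim, fun hv => by cases hv.1⟩
  | bot => exact ⟨fun hv => hv.elim, fun hv => by cases hv.1⟩

theorem sub_of_frame {h : PHeap} {H : Finmap fun _ : Loc => Val} {x : Loc → Ex Val}
    (hx : (fun l => Ex.ofOption (H.lookup l)) = (fun l => Ex.ofOption (h l)) + x) : h.Sub H :=
  fun l v hl => by
    have := congrFun hx l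
    simp only [Pi.add_apply, hl] at this
    exact Ex.ofOption_eq_some this

/-- Validity of a composition passes to the part with the authoritative element. -/
theorem valid_of_valid_add {r c : Res} (h : (r + c).Valid) (hr : r.1 ≠ 0) : r.Valid := by
  obtain ⟨r₁, r₂⟩ := r
  obtain ⟨c₁, c₂⟩ := c
  cases r₁ with
  | unit => exact absurd rfl hr
  | bot => cases c₁ <;> exact h.elim
  | own a =>
    cases c₁ with
    | unit =>
      obtain ⟨⟨x, hx⟩, hv⟩ := h
      exact ⟨⟨c₂ + x, by rw [hx]; exact add_assoc _ _ _⟩, hv⟩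
    | own b => exact h.elim
    | bot => exact h.elim

/-- The frame-preserving updates that the coupling of two programs needs: both heaps and the right
program change, and credits are spent. -/
theorem valid_update {h h' h₂ h₂' : PHeap} {e' e₂' : Expr} {ε ε₁ δ : ℝ≥0} {σ σ' σ₂ σ₂' : State}
    {c : Res} (hv : (owned h e' h' ε + authState σ (e', σ') ε₁ + c).Valid)
    (hu : HeapUpd h σ.heap h₂ σ₂.heap) (ht : σ₂.tapes = σ.tapes)
    (hu' : HeapUpd h' σ'.heap h₂' σ₂'.heap) (ht' : σ₂'.tapes = σ'.tapes) (hδ : δ ≤ ε) :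
    (owned h₂ e₂' h₂' δ + authState σ₂ (e₂', σ₂') (δ + (ε₁ - ε)) + c).Valid := by
  rw [valid_owned_add_iff] at hv ⊢
  obtain ⟨hc, hlt, x, h1, h2, h3, h4, h5, h6⟩ := hv
  have hx : ε₁ - ε = (c.2 + x).2.2.2.2.2 := by rw [h6, add_tsub_cancel_left]
  refine ⟨hc, ?_, x, hu.frame h1, ht ▸ h2, ?_, hu'.frame h4, ht' ▸ h5, by rw [hx]⟩
  · rw [hx]
    exact (add_le_add_left hδ _).trans_lt (h6 ▸ hlt)
  · rw [(Ex.own_add_eq_own h3.symm).1, add_zero]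

/-! ### From coupled programs to the refinement assertion -/

theorem upd_intro {P : IProp} {n : ℕ} {a : Res} (h : P.holds n a) : (IProp.upd P).holds n a :=
  fun _ hm _ hf => ⟨a, hf, mono_index hm h⟩

/-- The continuation of the outer coupling precondition in the equation of `wp`. -/
noncomputable def wpBody (Φ : Val → IProp) (e : Expr) (σ : State) (ρ' : Conf) (ε : ℝ≥0) : IProp :=
  IProp.or
    (IProp.ex fun v : Val => IProp.and (IProp.pure (e = .val v)) <|
      IProp.upd (IProp.sep (stateInterp σ ρ' ε) (Φ v)))
    (IProp.and (IProp.pure (e.toVal = none)) <|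
      progCoupl (e, σ) ρ' ε fun ρ₃ ρ₃' ε₃ =>
        IProp.later <| specCoupl ρ₃.2 ρ₃' ε₃ fun σ₄ ρ₄' ε₄ =>
          IProp.upd (IProp.sep (stateInterp σ₄ ρ₄' ε₄) (wp ρ₃.1 Φ)))

theorem specCoupl_base {Φ : State → Conf → ℝ≥0 → IProp} {σ : State} {ρ : Conf} {ε : ℝ≥0} {n : ℕ}
    {a : Res} (hv : a.Valid) (h : (Φ σ ρ ε).holds n a) : (specCoupl σ ρ ε Φ).holds n a :=
  fun _ hX => hX σ ρ ε n a hv (Or.inr (Or.inl h))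

theorem erasable_ret (σ : State) : Erasable (ret σ) σ := fun e n => by simp

theorem pexec_one {e : Expr} (h : e.toVal = none) (σ : State) : pexec 1 (e, σ) = step e σ := by
  rw [pexec, h]
  exact bind_ret _

/-- A deterministic step of the right program before the left program moves. -/
theorem specCoupl_right {Φ : State → Conf → ℝ≥0 → IProp} {σ σ' : State} {e' : Expr} {ρ₂' : Conf}
    {ε : ℝ≥0} {n : ℕ} {a : Res} (hv : a.Valid) (hε : ε ≤ 1) (he : e'.toVal = none)
    (hst : step e' σ' = ret ρ₂') (h : (IProp.upd (specCoupl σ ρ₂' ε Φ)).holds n a) :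
    (specCoupl σ (e', σ') ε Φ).holds n a := fun X hX => by
  refine hX _ _ _ n a hv (Or.inr (Or.inr ⟨fun σ₂ ρ => σ₂ = σ ∧ ρ = ρ₂', 1, ret σ, ret σ', 0,
    fun _ => ε, ⟨?_, fun _ => hε, ?_, erasable_ret σ, erasable_ret σ'⟩, ?_⟩))
  · simp only [ret_bind, pexec_one he, hst]
    exact ARCoupl.ret ⟨rfl, rfl⟩
  · simp [pexec_one he, hst]
  · rintro _ _ ⟨rfl, rfl⟩
    exact upd_imp (P := specCoupl _ _ _ Φ) (fun m hm b hb => hb X hX) h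

/-- The weakest precondition may be proved against an arbitrary state interpretation with any
compatible frame. -/
theorem wp_intro {e e' : Expr} {h h' : PHeap} {ε : ℝ≥0} {Φ : Val → IProp} {n : ℕ}
    (H : ∀ m ≤ n, ∀ (σ σ' : State) (ε₁ : ℝ≥0) (c : Res),
      (owned h e' h' ε + authState σ (e', σ') ε₁ + c).Valid →
      h.Sub σ.heap → h'.Sub σ'.heap → ε₁ < 1 →
      (specCoupl σ (e', σ') ε₁ (wpBody Φ e)).holds m
        (owned h e' h' ε + authState σ (e', σ') ε₁ + c)) :
    (wp e Φ).holds n (owned h e' h' ε) := by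
  rw [wp_unfold]
  rintro σ ⟨e'', σ'⟩ ε₁ m hm b hv ⟨c, hc⟩
  change b = authState σ (e'', σ') ε₁ + c at hc
  rw [hc, ← add_assoc] at hv ⊢
  obtain ⟨hc, hlt, x, h1, h2, h3, h4, h5, h6⟩ := valid_owned_add_iff.1 hv
  obtain rfl := (Ex.own_add_eq_own h3.symm).2
  exact upd_intro (H m hm σ σ' ε₁ c hv (sub_of_frame h1) (sub_of_frame h4) hlt)

section Update

variable {h h' h₂ h₂' : PHeap} {e e' e₂' : Expr} {ε ε₁ δ : ℝ≥0} {σ σ' σ₂ σ₂' : State} {c : Res}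
  {Φ : Val → IProp} {n : ℕ}

/-- Reestablishing the state interpretation after a step. The credits `ε₁ - ε` in excess of the
owned ones belong to the frame and are kept. -/
theorem upd_sep_wp (hu : HeapUpd h σ.heap h₂ σ₂.heap) (ht : σ₂.tapes = σ.tapes)
    (hu' : HeapUpd h' σ'.heap h₂' σ₂'.heap) (ht' : σ₂'.tapes = σ'.tapes) (hδ : δ ≤ ε)
    (hw : (wp e Φ).holds n (owned h₂ e₂' h₂' δ)) :
    (IProp.upd (IProp.sep (stateInterp σ₂ (e₂', σ₂') (δ + (ε₁ - ε))) (wp e Φ))).holds n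
      (owned h e' h' ε + authState σ (e', σ') ε₁ + c) := by
  intro m hm f hf
  rw [add_assoc] at hf
  refine ⟨owned h₂ e₂' h₂' δ + authState σ₂ (e₂', σ₂') (δ + (ε₁ - ε)) + c, ?_,
    authState σ₂ (e₂', σ₂') (δ + (ε₁ - ε)) + c, owned h₂ e₂' h₂' δ, ?_, ⟨c, rfl⟩,
    mono_index hm hw⟩
  · rw [add_assoc]
    exact valid_update hf hu ht hu' ht' hδ
  · rw [add_assoc, add_comm]

/-- As `upd_sep_wp`, but entering the weakest precondition of the unchanged left program with the
new state interpretation. -/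
theorem upd_specCoupl (hu : HeapUpd h σ.heap h₂ σ₂.heap) (ht : σ₂.tapes = σ.tapes)
    (hu' : HeapUpd h' σ'.heap h₂' σ₂'.heap) (ht' : σ₂'.tapes = σ'.tapes) (hδ : δ ≤ ε)
    (hw : (wp e Φ).holds n (owned h₂ e₂' h₂' δ)) :
    (IProp.upd (specCoupl σ₂ (e₂', σ₂') (δ + (ε₁ - ε)) (wpBody Φ e))).holds n
      (owned h e' h' ε + authState σ (e', σ') ε₁ + c) := by
  intro m hm f hf
  rw [add_assoc] at hf
  have hf₂ := valid_update (e₂' := e₂') hf hu ht hu' ht' hδ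
  have hv : (owned h₂ e₂' h₂' δ + (authState σ₂ (e₂', σ₂') (δ + (ε₁ - ε)) + c)).Valid := by
    refine valid_of_valid_add (c := f) (by simpa only [add_assoc] using hf₂) ?_
    obtain ⟨c₁, c₂⟩ := c
    cases c₁ <;> exact fun h0 => by cases h0
  refine (wp_unfold e Φ n _).1 hw σ₂ (e₂', σ₂') _ m hm _ hv ⟨c, rfl⟩ m le_rfl f ?_
  simpa only [add_assoc] using hf₂

end Update

/-- The postcondition of the refinement assertion with equality of the results. -/
noncomputable def eqPost (K : Ectx) (v : Val) : IProp :=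
  IProp.ex fun v' : Val => IProp.sep (spec (K.fill (.val v'))) (IProp.pure (v = v'))

theorem expect_const_coe_le {A : Type} (μ : SubDistr A) {ε₁ δ ε : ℝ≥0} (h : ε₁ + δ ≤ ε) :
    (ε₁ : ℝ≥0∞) + μ.expect (fun _ => (δ : ℝ≥0∞)) ≤ ε :=
  (add_le_add_right (μ.expect_const_le _) _).trans (by exact_mod_cast h)

/-- Coupled programs satisfy the weakest precondition of the refinement assertion. The step index
is arbitrary, since the derivation of `Coupled` is well-founded. -/
theorem Coupled.wp {e e' : Expr} {h h' : PHeap} {ε : ℝ≥0} (H : Coupled e h e' h' ε) (C : Ectx) :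
    ∀ n, (wp e (eqPost C)).holds n (owned h (C.fill e') h' ε) := by
  induction H with
  | val v h h' ε =>
    intro n
    refine wp_intro fun m hm σ σ' ε₁ c hv _ _ _ => specCoupl_base hv (Or.inl ⟨v, rfl, ?_⟩)
    refine upd_intro ⟨authState σ (C.fill (.val v), σ') ε₁ + c, owned h (C.fill (.val v)) h' ε,
      ?_, ⟨c, rfl⟩, v, (0, (0, 0, .own (C.fill (.val v)), 0, 0, 0)),
      (0, (fun l => .ofOption (h l), 0, 0, fun l => .ofOption (h' l), 0, ε)), ?_, ⟨0, ?_⟩, rfl⟩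
    · rw [add_assoc, add_comm]
    · simp [owned]
    · exact (add_zero _).symm
  | @left e e' h h' ε e₂ h₂ hs _ ih =>
    intro n
    refine wp_intro fun m hm σ σ' ε₁ c hv hσ _ hlt => specCoupl_base hv (Or.inr ⟨hs.1, ?_⟩)
    obtain ⟨H₂, hst, hu⟩ := hs.2 σ hσ
    have hε : ε ≤ ε₁ := by
      obtain ⟨-, -, x, -, -, -, -, -, h6⟩ := valid_owned_add_iff.1 hv
      exact h6 ▸ le_self_add
    refine ⟨fun ρ ρ' => ρ = (e₂ σ, ⟨H₂, σ.tapes⟩) ∧ ρ' = (C.fill e', σ'), 0, ret σ', 0,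
      fun _ => ε + (ε₁ - ε), ⟨?_, ⟨(e₂ σ, ⟨H₂, σ.tapes⟩), ?_⟩, fun _ => ?_,
        expect_const_coe_le _ ?_, erasable_ret σ'⟩, ?_⟩
    · rw [ret_bind, hst]
      exact ARCoupl.ret ⟨rfl, rfl⟩
    · rw [hst, ret_apply_self]
      exact one_pos
    · rw [add_tsub_cancel_of_le hε]; exact hlt.le
    · rw [zero_add, add_tsub_cancel_of_le hε]
    · rintro _ _ ⟨rfl, rfl⟩
      refine upd_intro ?_
      rintro k rfl
      exact specCoupl_base hv
        (upd_sep_wp hu rfl (HeapUpd.refl _ _) rfl le_rfl (ih σ hσ k))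
  | @right e e' h h' ε e₂ h₂ hs _ ih =>
    intro n
    refine wp_intro fun m hm σ σ' ε₁ c hv _ hσ' hlt => ?_
    obtain ⟨H₂, hst, hu⟩ := hs.2 σ' hσ'
    have hε : ε ≤ ε₁ := by
      obtain ⟨-, -, x, -, -, -, -, -, h6⟩ := valid_owned_add_iff.1 hv
      exact h6 ▸ le_self_add
    refine specCoupl_right (ρ₂' := (C.fill (e₂ σ'), ⟨H₂, σ'.tapes⟩)) hv hlt.le
      (C.toVal_fill hs.1) (by rw [C.step_fill hs.1, hst, map_ret]) ?_
    have := upd_specCoupl (ε₁ := ε₁) (c := c) (σ₂' := ⟨H₂, σ'.tapes⟩)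
      (HeapUpd.refl h σ.heap) rfl hu rfl le_rfl (ih σ' hσ' m) (e' := C.fill e')
    rwa [add_tsub_cancel_of_le hε] at this
  | @rand h h' ε ε₁ δ M M' K K' R h₁ h₂ hδ _ ih =>
    intro n
    refine wp_intro fun m hm σ σ' ε₂ c hv _ _ hlt =>
      specCoupl_base hv (Or.inr ⟨K.toVal_fill rfl, ?_⟩)
    have hε : ε ≤ ε₂ := by
      obtain ⟨-, -, x, -, -, -, -, -, h6⟩ := valid_owned_add_iff.1 hv
      exact h6 ▸ le_self_add
    have hle : ε₁ + (δ + (ε₂ - ε)) ≤ ε₂ := by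
      rw [← add_assoc]
      exact (add_le_add_left hδ _).trans (add_tsub_cancel_of_le hε).le
    refine ⟨fun ρ ρ' => ∃ k j, R k j ∧ ρ = (K.fill (.val (.int (k : ℕ))), σ) ∧
      ρ' = (C.fill (K'.fill (.val (.int (j : ℕ)))), σ'), 1, ret σ', ε₁,
      fun _ => δ + (ε₂ - ε), ⟨?_, ⟨(K.fill (.val (.int (0 : ℕ))), σ), ?_⟩, fun _ => ?_,
        expect_const_coe_le _ hle, erasable_ret σ'⟩, ?_⟩
    · rw [ret_bind, pexec_one (C.toVal_fill (K'.toVal_fill rfl)), ← Ectx.fill_append,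
        step_rand, step_rand]
      refine h₁.map fun k j hkj => ⟨k, j, hkj, rfl, ?_⟩
      rw [Ectx.fill_append]
    · rw [step_rand]
      exact map_apply_pos _ (unif_apply_pos M 0)
    · exact (le_add_self.trans hle).trans hlt.le
    · rintro _ _ ⟨k, j, hkj, rfl, rfl⟩
      refine upd_intro ?_
      rintro i rfl
      exact specCoupl_base hv (upd_sep_wp (HeapUpd.refl _ _) rfl (HeapUpd.refl _ _) rfl
        (le_add_self.trans hδ) (ih k j hkj i))

theorem Coupled.entails_wpRef {e e' : Expr} {ε : ℝ≥0}
    (H : Coupled e (fun _ => none) e' (fun _ => none) ε) :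
    IProp.Entails (upto ε) (wpRef e e' fun v v' => IProp.pure (v = v')) := by
  rintro n _ - ⟨c, rfl⟩ C m hm _ - ⟨d, rfl⟩
  have hres : ((0, (0, 0, 0, 0, 0, ε)) + (0, (0, 0, .own (C.fill e'), 0, 0, 0)) : Res)
      = owned (fun _ => none) (C.fill e') (fun _ => none) ε := by
    simp [owned]
    rfl
  rw [add_add_add_comm, hres]
  exact (ProbLang.wp e (eqPost C)).mono le_rfl (H.wp C m)

/-! ### Deterministic executions -/

/-- A deterministic step whose result does not depend on the state. -/
def DetStep (e : Expr) (h : PHeap) (e₂ : Expr) (h₂ : PHeap) : Prop :=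
  StepsTo e h (fun _ => e₂) fun _ => h₂

/-- Finitely many deterministic steps. -/
inductive RunsTo : Expr → PHeap → Expr → PHeap → Prop
  | refl (e : Expr) (h : PHeap) : RunsTo e h e h
  | head {e e₁ e₂ : Expr} {h h₁ h₂ : PHeap} :
      DetStep e h e₁ h₁ → RunsTo e₁ h₁ e₂ h₂ → RunsTo e h e₂ h₂

theorem StepsTo.fill {e : Expr} {h : PHeap} {e₂ : State → Expr} {h₂ : State → PHeap}
    (hs : StepsTo e h e₂ h₂) (K : Ectx) :
    StepsTo (K.fill e) h (fun σ => K.fill (e₂ σ)) h₂ :=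
  ⟨K.toVal_fill hs.1, fun σ hσ => by
    obtain ⟨H₂, hst, hu⟩ := hs.2 σ hσ
    exact ⟨H₂, by rw [K.step_fill hs.1, hst, map_ret], hu⟩⟩

theorem stepsTo_alloc (v : Val) (h : PHeap) :
    StepsTo (.allocN (.val (.int 1)) (.val v)) h (fun σ => .val (.loc (freshLoc σ.heap)))
      fun σ => Function.update h (freshLoc σ.heap) (some v) :=
  ⟨rfl, fun σ hσ => by
    have hl : h (freshLoc σ.heap) = none := by
      cases hv : h (freshLoc σ.heap) with
      | none => rfl
      | some v => simpa [lookup_freshLoc] using hσ _ _ hv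
    refine ⟨σ.heap.insert (freshLoc σ.heap) v, ?_,
      HeapUpd.insert (hl.trans (lookup_freshLoc _).symm) v⟩
    rw [step_of_decomp_eq_none rfl]
    simp [headStep, heapBlock]⟩

theorem DetStep.of_headStep {e e₂ : Expr} {h : PHeap} (hv : e.toVal = none)
    (hd : e.decomp = none) (hs : ∀ σ, headStep e σ = ret (e₂, σ)) : DetStep e h e₂ h :=
  ⟨hv, fun σ _ => ⟨σ.heap, by rw [step_of_decomp_eq_none hd, hs], HeapUpd.refl _ _⟩⟩

namespace RunsTo

variable {e e₁ e₂ e₃ : Expr} {h h₁ h₂ h₃ : PHeap} {v w u : Val} {l : Loc}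

theorem single (hs : DetStep e h e₂ h₂) : RunsTo e h e₂ h₂ := head hs (refl _ _)

theorem trans (r₁ : RunsTo e h e₂ h₂) (r₂ : RunsTo e₂ h₂ e₃ h₃) : RunsTo e h e₃ h₃ := by
  induction r₁ with
  | refl => exact r₂
  | head hs _ ih => exact head hs (ih r₂)

theorem fill (r : RunsTo e h e₂ h₂) (K : Ectx) : RunsTo (K.fill e) h (K.fill e₂) h₂ := by
  induction r with
  | refl => exact refl _ _
  | head hs _ ih => exact head (StepsTo.fill hs K) ih

theorem frame (F : Frame) (r : RunsTo e h e₂ h₂) : RunsTo (F.fill e) h (F.fill e₂) h₂ :=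
  r.fill [F]

theorem of_headStep (hv : e.toVal = none) (hd : e.decomp = none)
    (hs : ∀ σ, headStep e σ = ret (e₂, σ)) : RunsTo e h e₂ h :=
  single (.of_headStep hv hd hs)

theorem fix (f x : Binder) (e : Expr) (h : PHeap) :
    RunsTo (.fix f x e) h (.val (.fix f x e)) h :=
  of_headStep rfl rfl fun _ => rfl

/-- Right-to-left evaluation of an application, followed by the body of the function. -/
theorem app {f x : Binder} {b : Expr} (r₂ : RunsTo e₂ h (.val v) h₁)
    (r₁ : RunsTo e₁ h₁ (.val (.fix f x b)) h₂)
    (r : RunsTo ((b.substB x v).substB f (.fix f x b)) h₂ e₃ h₃) :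
    RunsTo (.app e₁ e₂) h e₃ h₃ :=
  (frame (.appR e₁) r₂).trans <| (frame (.appL v) r₁).trans <|
    (of_headStep rfl rfl fun _ => rfl).trans r

theorem binop {op : BinOp} (r₂ : RunsTo e₂ h (.val v) h₁) (r₁ : RunsTo e₁ h₁ (.val w) h₂)
    (ho : binopEval op w v = some u) : RunsTo (.binop op e₁ e₂) h (.val u) h₂ :=
  (frame (.binopR op e₁) r₂).trans <| (frame (.binopL op v) r₁).trans <|
    of_headStep rfl rfl fun _ => by simp [headStep, Frame.fill, ho, retOpt]

theorem ite {b : Bool} (r : RunsTo e h (.val (.bool b)) h₁)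
    (r' : RunsTo (if b then e₁ else e₂) h₁ e₃ h₃) : RunsTo (.ite e e₁ e₂) h e₃ h₃ :=
  (frame (.ite e₁ e₂) r).trans <| (of_headStep rfl rfl fun _ => rfl).trans r'

theorem pair (r₂ : RunsTo e₂ h (.val v) h₁) (r₁ : RunsTo e₁ h₁ (.val w) h₂) :
    RunsTo (.pair e₁ e₂) h (.val (.pair w v)) h₂ :=
  (frame (.pairR e₁) r₂).trans <| (frame (.pairL v) r₁).trans <|
    of_headStep rfl rfl fun _ => rfl

theorem fst (r : RunsTo e h (.val (.pair v w)) h₁) : RunsTo (.fst e) h (.val v) h₁ :=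
  (frame .fst r).trans <| of_headStep rfl rfl fun _ => rfl

theorem snd (r : RunsTo e h (.val (.pair v w)) h₁) : RunsTo (.snd e) h (.val w) h₁ :=
  (frame .snd r).trans <| of_headStep rfl rfl fun _ => rfl

theorem inl (r : RunsTo e h (.val v) h₁) : RunsTo (.inl e) h (.val (.inl v)) h₁ :=
  (frame .inl r).trans <| of_headStep rfl rfl fun _ => rfl

theorem inr (r : RunsTo e h (.val v) h₁) : RunsTo (.inr e) h (.val (.inr v)) h₁ :=
  (frame .inr r).trans <| of_headStep rfl rfl fun _ => rfl

theorem case_inl (r : RunsTo e h (.val (.inl v)) h₁)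
    (r' : RunsTo (.app e₁ (.val v)) h₁ e₃ h₃) : RunsTo (.case e e₁ e₂) h e₃ h₃ :=
  (frame (.case e₁ e₂) r).trans <| (of_headStep rfl rfl fun _ => rfl).trans r'

theorem case_inr (r : RunsTo e h (.val (.inr v)) h₁)
    (r' : RunsTo (.app e₂ (.val v)) h₁ e₃ h₃) : RunsTo (.case e e₁ e₂) h e₃ h₃ :=
  (frame (.case e₁ e₂) r).trans <| (of_headStep rfl rfl fun _ => rfl).trans r'

theorem load (r : RunsTo e h (.val (.loc l)) h₁) (hl : h₁ l = some v) :
    RunsTo (.load e) h (.val v) h₁ :=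
  (frame .load r).trans <| single ⟨rfl, fun σ hσ => ⟨σ.heap, by
    rw [step_of_decomp_eq_none rfl]
    simp [headStep, Frame.fill, hσ l v hl, retOpt], HeapUpd.refl _ _⟩⟩

theorem store (r₂ : RunsTo e₂ h (.val v) h₁) (r₁ : RunsTo e₁ h₁ (.val (.loc l)) h₂)
    (hl : h₂ l = some w) :
    RunsTo (.store e₁ e₂) h (.val .unit) (Function.update h₂ l (some v)) :=
  (frame (.storeR e₁) r₂).trans <| (frame (.storeL v) r₁).trans <|
    single ⟨rfl, fun σ hσ => ⟨σ.heap.insert l v, by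
      rw [step_of_decomp_eq_none rfl]
      simp [headStep, Frame.fill, hσ l w hl, retOpt], HeapUpd.insert (hσ.lookup_eq hl) v⟩⟩

/-- Evaluation of the operands of an application, up to the call. -/
theorem app₁ (r₂ : RunsTo e₂ h (.val v) h₁) (r₁ : RunsTo e₁ h₁ (.val w) h₂)
    (r : RunsTo (.app (.val w) (.val v)) h₂ e₃ h₃) : RunsTo (.app e₁ e₂) h e₃ h₃ :=
  (frame (.appR e₁) r₂).trans <| (frame (.appL v) r₁).trans r

/-- Evaluation of the operands of a curried application to two arguments, up to the call. -/
theorem app₂ {e' : Expr} {h' : PHeap} (r₂ : RunsTo e₂ h (.val v) h₁)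
    (r₁ : RunsTo e₁ h₁ (.val w) h₂) (r₀ : RunsTo e h₂ (.val u) h₃)
    (r : RunsTo (.app (.app (.val u) (.val w)) (.val v)) h₃ e' h') :
    RunsTo (.app (.app e e₁) e₂) h e' h' :=
  (frame (.appR (.app e e₁)) r₂).trans <| (fill r₁ [.appL v, .appR e]).trans <|
    (fill r₀ [.appL v, .appL w]).trans r

theorem letIn {x : ℕ} (r₁ : RunsTo e₁ h (.val v) h₁) (r : RunsTo (e₂.subst x v) h₁ e₃ h₃) :
    RunsTo (.letIn x e₁ e₂) h e₃ h₃ :=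
  app r₁ (fix ..) r

theorem seq (r₁ : RunsTo e₁ h (.val v) h₁) (r : RunsTo e₂ h₁ e₃ h₃) :
    RunsTo (.seq e₁ e₂) h e₃ h₃ :=
  app r₁ (fix ..) r

theorem cons (r₂ : RunsTo e₂ h (.val v) h₁) (r₁ : RunsTo e₁ h₁ (.val w) h₂) :
    RunsTo (.cons e₁ e₂) h (.val (.inr (.pair w v))) h₂ :=
  inr (pair r₂ r₁)

theorem content (r : RunsTo e h (.val (.inr v)) h₁) : RunsTo (.content e) h (.val v) h₁ :=
  case_inr r (app (refl _ _) (fix ..) (refl _ _))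

end RunsTo

theorem binopEval_eq_int (a b : ℤ) :
    binopEval .eq (.int a) (.int b) = some (.bool (decide (a = b))) := by
  simp [binopEval, Val.IsUnboxed]

theorem binopEval_eq_inl_unit (v : Val) (b : Bool) (h : b = true ↔ v = .inl .unit) :
    binopEval .eq v (.inl .unit) = some (.bool b) := by
  simp [binopEval, Val.IsUnboxed, ← h]

/-! ### Lists and maps of the language -/

/-- The encoding of a list of values. -/
def listVal : List Val → Val
  | [] => .inl .unit
  | v :: L => .inr (.pair v (listVal L))

/-- The encoding of a list of natural numbers. -/
def natsVal (L : List ℕ) : Val := listVal (L.map fun n : ℕ => .int n)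

/-- The encoding of an association list. -/
def assocVal (a : List (ℕ × ℕ)) : Val :=
  listVal (a.map fun p => .pair (.int p.1) (.int p.2))

theorem runsTo_listLength (L : List Val) (h : PHeap) :
    RunsTo (.app (.val listLength) (.val (listVal L))) h (.val (.int L.length)) h := by
  induction L with
  | nil =>
    apply RunsTo.app (.refl _ _) (.refl _ _)
    apply RunsTo.case_inl (.refl _ _)
    exact RunsTo.app (.refl _ _) (.fix ..) (.refl _ _)
  | cons v L ih =>
    apply RunsTo.app (.refl _ _) (.refl _ _)
    apply RunsTo.case_inr (.refl _ _)
    apply RunsTo.app (.refl _ _) (.fix ..)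
    apply RunsTo.binop (RunsTo.app₁ (.snd (.refl _ _)) (.refl _ _) ih) (.refl _ _)
    simp [binopEval, add_comm]

theorem runsTo_listSeq (n i : ℕ) (h : PHeap) :
    RunsTo (.app (.app (.val listSeq) (.val (.int i))) (.val (.int n))) h
      (.val (natsVal (List.range' i n))) h := by
  induction n generalizing i with
  | zero =>
    apply RunsTo.app (.refl _ _)
    · exact .app (.refl _ _) (.refl _ _) (.fix ..)
    apply RunsTo.ite (.binop (.refl _ _) (.refl _ _) (binopEval_eq_int _ _))
    exact .inl (.refl _ _)
  | succ n ih =>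
    apply RunsTo.app (.refl _ _)
    · exact .app (.refl _ _) (.refl _ _) (.fix ..)
    apply RunsTo.ite (.binop (.refl _ _) (.refl _ _) (binopEval_eq_int _ _))
    rw [decide_eq_false (by omega)]
    refine RunsTo.cons (RunsTo.app₂ (.binop (.refl _ _) (.refl _ _) (u := .int n) ?_)
      (.binop (.refl _ _) (.refl _ _) (u := .int (i + 1 : ℕ)) ?_) (.refl _ _) (ih (i + 1)))
      (.refl _ _)
    · simp [binopEval]
    · simp [binopEval]

theorem runsTo_listNth (L : List Val) (k : ℕ) (hk : k < L.length) (h : PHeap) :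
    RunsTo (.app (.app (.val listNth) (.val (listVal L))) (.val (.int k))) h
      (.val (.inr L[k])) h := by
  induction L generalizing k with
  | nil => simp at hk
  | cons v L ih =>
    apply RunsTo.app (.refl _ _)
    · exact .app (.refl _ _) (.refl _ _) (.fix ..)
    apply RunsTo.case_inr (.refl _ _)
    apply RunsTo.app (.refl _ _) (.fix ..)
    apply RunsTo.ite (.binop (.refl _ _) (.refl _ _) (binopEval_eq_int _ _))
    cases k with
    | zero => exact .inr (.fst (.refl _ _))
    | succ k =>
      rw [decide_eq_false (by omega)]
      refine RunsTo.app₂ (.binop (.refl _ _) (.refl _ _) (u := .int k) ?_) (.snd (.refl _ _))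
        (.refl _ _) (ih k (by simpa using hk))
      simp [binopEval]

theorem runsTo_listRemoveNth (L : List Val) (k : ℕ) (h : PHeap) :
    RunsTo (.app (.app (.val listRemoveNth) (.val (listVal L))) (.val (.int k))) h
      (.val (listVal (L.eraseIdx k))) h := by
  induction L generalizing k with
  | nil =>
    apply RunsTo.app (.refl _ _)
    · exact .app (.refl _ _) (.refl _ _) (.fix ..)
    apply RunsTo.case_inl (.refl _ _)
    exact RunsTo.app (.refl _ _) (.fix ..) (.inl (.refl _ _))
  | cons v L ih =>
    apply RunsTo.app (.refl _ _)
    · exact .app (.refl _ _) (.refl _ _) (.fix ..)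
    apply RunsTo.case_inr (.refl _ _)
    apply RunsTo.app (.refl _ _) (.fix ..)
    apply RunsTo.ite (.binop (.refl _ _) (.refl _ _) (binopEval_eq_int _ _))
    cases k with
    | zero => exact .snd (.refl _ _)
    | succ k =>
      rw [decide_eq_false (by omega)]
      refine RunsTo.cons (RunsTo.app₂ (.binop (.refl _ _) (.refl _ _) (u := .int k) ?_)
        (.snd (.refl _ _)) (.refl _ _) (ih k)) (.fst (.refl _ _))
      simp [binopEval]

/-- The encoding of an optional natural number. -/
def optVal : Option ℕ → Val
  | none => .inl .unit
  | some y => .inr (.int y)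

theorem runsTo_listAssoc (a : List (ℕ × ℕ)) (x : ℕ) (h : PHeap) :
    RunsTo (.app (.app (.val listAssoc) (.val (assocVal a))) (.val (.int x))) h
      (.val (optVal (a.lookup x))) h := by
  induction a with
  | nil =>
    apply RunsTo.app (.refl _ _)
    · exact .app (.refl _ _) (.refl _ _) (.fix ..)
    apply RunsTo.case_inl (.refl _ _)
    exact RunsTo.app (.refl _ _) (.fix ..) (.inl (.refl _ _))
  | cons p a ih =>
    apply RunsTo.app (.refl _ _)
    · exact .app (.refl _ _) (.refl _ _) (.fix ..)
    apply RunsTo.case_inr (.refl _ _)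
    apply RunsTo.app (.refl _ _) (.fix ..)
    apply RunsTo.ite (.binop (.refl _ _) (.fst (.fst (.refl _ _))) (binopEval_eq_int _ _))
    by_cases hx : x = p.1
    · rw [decide_eq_true (by omega), List.lookup_cons, beq_iff_eq.2 hx]
      exact .inr (.snd (.fst (.refl _ _)))
    · rw [decide_eq_false (by omega), List.lookup_cons, beq_eq_false_iff_ne.2 hx]
      exact RunsTo.app₂ (.refl _ _) (.snd (.refl _ _)) (.refl _ _) ih

theorem runsTo_mapGet {h : PHeap} {m : Loc} {a : List (ℕ × ℕ)} (hm : h m = some (assocVal a))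
    (x : ℕ) :
    RunsTo (.app (.app (.val mapGet) (.val (.loc m))) (.val (.int x))) h
      (.val (optVal (a.lookup x))) h := by
  apply RunsTo.app (.refl _ _)
  · exact .app (.refl _ _) (.refl _ _) (.fix ..)
  exact RunsTo.app₂ (.refl _ _) (.load (.refl _ _) hm) (.refl _ _) (runsTo_listAssoc a x h)

theorem runsTo_mapSet {h : PHeap} {m : Loc} {a : List (ℕ × ℕ)} (hm : h m = some (assocVal a))
    (x y : ℕ) :
    RunsTo (.app (.app (.app (.val mapSet) (.val (.loc m))) (.val (.int x))) (.val (.int y))) h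
      (.val .unit) (Function.update h m (some (assocVal ((x, y) :: a)))) := by
  apply RunsTo.app (.refl _ _)
  · apply RunsTo.app (.refl _ _)
    · exact .app (.refl _ _) (.refl _ _) (.fix ..)
    · exact .fix ..
  exact RunsTo.store (.cons (.load (.refl _ _) hm) (.pair (.refl _ _) (.refl _ _)))
    (.refl _ _) hm

namespace Coupled

variable {e e' e₂ e₂' : Expr} {h h' h₂ h₂' : PHeap} {ε : ℝ≥0}

theorem runsTo_left (r : RunsTo e h e₂ h₂) (H : Coupled e₂ h₂ e' h' ε) : Coupled e h e' h' ε := by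
  induction r with
  | refl => exact H
  | head hs _ ih => exact .left hs fun _ _ => ih H

theorem runsTo (r : RunsTo e h e₂ h₂) (r' : RunsTo e' h' e₂' h₂')
    (H : Coupled e₂ h₂ e₂' h₂' ε) : Coupled e h e' h' ε :=
  runsTo_left r (runsTo_left r' H.symm).symm

theorem alloc_left (K : Ectx) {v : Val}
    (H : ∀ l, h l = none →
      Coupled (K.fill (.val (.loc l))) (Function.update h l (some v)) e' h' ε) :
    Coupled (K.fill (.allocN (.val (.int 1)) (.val v))) h e' h' ε :=
  .left ((stepsTo_alloc v h).fill K) fun σ hσ => H _ <| by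
    cases hv : h (freshLoc σ.heap) with
    | none => rfl
    | some v => simpa [lookup_freshLoc] using hσ _ _ hv

theorem alloc_right (K : Ectx) {v : Val}
    (H : ∀ l, h' l = none →
      Coupled e h (K.fill (.val (.loc l))) (Function.update h' l (some v)) ε) :
    Coupled e h (K.fill (.allocN (.val (.int 1)) (.val v))) h' ε :=
  (alloc_left K fun l hl => (H l hl).symm).symm

end Coupled

open ProbLang.Expr


theorem binopEval_sub_one (n : ℕ) :
    binopEval .sub (.int (n + 1 : ℕ)) (.int 1) = some (.int n) := by
  simp [binopEval]

/-! ### The random function -/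

/-- The function that `rfImpl` returns when its map is at location `m`. -/
def rfFun (N : ℕ) (m : Loc) : Val :=
  .lam xx <|
    seq
      (.ite (.binop .eq ((mapGet : Expr) (Val.loc m) (var xx)) optNone)
        (letIn xy (.rand (.binop .sub (int N) (int 1))) <|
          (mapSet : Expr) (Val.loc m) (var xx) (var xy))
        unit)
      (content ((mapGet : Expr) (Val.loc m) (var xx)))

/-- The setup of the random function, split at its allocation. -/
theorem rfImpl_runsTo (N : ℕ) : ∃ K : Ectx,
    (∀ h, RunsTo ((rfImpl : Expr) (int N)) h
      (K.fill (.allocN (.val (.int 1)) (.val (assocVal [])))) h) ∧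
    ∀ m h, RunsTo (K.fill (.val (.loc m))) h (.val (rfFun N m)) h := by
  -- The expressions left open in the context are found by unification during the execution.
  apply Exists.intro [.appR _]
  refine ⟨fun h => ?_, fun m h => ?_⟩
  · apply RunsTo.app (.refl _ _) (.refl _ _)
    apply RunsTo.frame (.appR _)
    apply RunsTo.app (.refl _ _) (.refl _ _)
    exact RunsTo.frame (.allocNR _) (.inl (.refl _ _))
  · exact .app (.refl _ _) (.fix ..) (.fix ..)

section Query

variable {h : PHeap} {m : Loc} {a : List (ℕ × ℕ)}

theorem rfFun_hit (N : ℕ) (hm : h m = some (assocVal a)) {x y : ℕ} (hx : a.lookup x = some y) :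
    RunsTo (.app (.val (rfFun N m)) (.val (.int x))) h (.val (.int y)) h := by
  have hget := runsTo_mapGet hm x
  rw [hx] at hget
  apply RunsTo.app (.refl _ _) (.refl _ _)
  apply RunsTo.seq
  · apply RunsTo.ite
    · exact .binop (.inl (.refl _ _)) hget (binopEval_eq_inl_unit _ false (by simp [optVal]))
    · exact .refl _ _
  · exact .content hget

/-- A fresh query to the random function runs to a sampling in some context; the context then
records the outcome and returns it. -/
theorem rfFun_miss (n : ℕ) (hm : h m = some (assocVal a)) {x : ℕ} (hx : a.lookup x = none) :
    ∃ K : Ectx,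
      RunsTo (.app (.val (rfFun (n + 1) m)) (.val (.int x))) h
        (K.fill (.rand (.val (.int n)))) h ∧
      ∀ y : ℕ, RunsTo (K.fill (.val (.int y))) h (.val (.int y))
        (Function.update h m (some (assocVal ((x, y) :: a)))) := by
  have hget := runsTo_mapGet hm x
  rw [hx] at hget
  apply Exists.intro [.appR _, .appR _]
  refine ⟨?_, fun y => ?_⟩
  · apply RunsTo.app (.refl _ _) (.refl _ _)
    apply RunsTo.frame (.appR _)
    apply RunsTo.ite
    · exact .binop (.inl (.refl _ _)) hget (binopEval_eq_inl_unit _ true (by simp [optVal]))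
    · exact .frame (.appR _) <| .frame .rand <|
        .binop (.refl _ _) (.refl _ _) (binopEval_sub_one n)
  · apply RunsTo.seq
    · exact RunsTo.app (.refl _ _) (.fix ..) (runsTo_mapSet hm x y)
    · have hget' := runsTo_mapGet (m := m) (a := (x, y) :: a)
        (h := Function.update h m (some (assocVal ((x, y) :: a)))) (by simp) x
      rw [List.lookup_cons_self] at hget'
      exact .content hget'

/-! ### The random permutation -/

/-- The function that `rpImpl` returns when its map is at location `m` and its list of unused
values at location `u`. -/
def rpFun (m u : Loc) : Val :=
  .lam xx <|
    seq
      (.ite (.binop .eq ((mapGet : Expr) (Val.loc m) (var xx)) optNone)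
        (letIn xlen ((listLength : Expr) (.load (Val.loc u))) <|
          letIn xk (.rand (.binop .sub (var xlen) (int 1))) <|
          letIn xy (content ((listNth : Expr) (.load (Val.loc u)) (var xk))) <|
          seq ((mapSet : Expr) (Val.loc m) (var xx) (var xy)) <|
            .store (Val.loc u) ((listRemoveNth : Expr) (.load (Val.loc u)) (var xk)))
        unit)
      (content ((mapGet : Expr) (Val.loc m) (var xx)))

/-- The setup of the random permutation, split at its two allocations. -/
theorem rpImpl_runsTo (N : ℕ) : ∃ K₁ : Ectx,
    (∀ h, RunsTo ((rpImpl : Expr) (int N)) h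
      (K₁.fill (.allocN (.val (.int 1)) (.val (assocVal [])))) h) ∧
    ∀ m, ∃ K₂ : Ectx,
      (∀ h, RunsTo (K₁.fill (.val (.loc m))) h
        (K₂.fill (.allocN (.val (.int 1)) (.val (natsVal (List.range' 0 N))))) h) ∧
      ∀ u h, RunsTo (K₂.fill (.val (.loc u))) h (.val (rpFun m u)) h := by
  apply Exists.intro [.appR _]
  refine ⟨fun h => ?_, fun m => ?_⟩
  · apply RunsTo.app (.refl _ _) (.refl _ _)
    apply RunsTo.frame (.appR _)
    apply RunsTo.app (.refl _ _) (.refl _ _)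
    exact RunsTo.frame (.allocNR _) (.inl (.refl _ _))
  · apply Exists.intro [.appR _]
    refine ⟨fun h => ?_, fun u h => ?_⟩
    · apply RunsTo.app (.refl _ _) (.fix ..)
      exact RunsTo.frame (.appR _) <| RunsTo.frame (.allocNR _) (runsTo_listSeq N 0 h)
    · exact .app (.refl _ _) (.fix ..) (.fix ..)

theorem rpFun_hit (u : Loc) (hm : h m = some (assocVal a)) {x y : ℕ}
    (hx : a.lookup x = some y) :
    RunsTo (.app (.val (rpFun m u)) (.val (.int x))) h (.val (.int y)) h := by
  have hget := runsTo_mapGet hm x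
  rw [hx] at hget
  apply RunsTo.app (.refl _ _) (.refl _ _)
  apply RunsTo.seq
  · apply RunsTo.ite
    · exact .binop (.inl (.refl _ _)) hget (binopEval_eq_inl_unit _ false (by simp [optVal]))
    · exact .refl _ _
  · exact .content hget

/-- A fresh query to the random permutation runs to the sampling of a position in the list of unused
values; the context then moves the value at that position from the list to the map. -/
theorem rpFun_miss {u : Loc} {L : List ℕ} {c : ℕ} (hmu : m ≠ u) (hm : h m = some (assocVal a))
    (hu : h u = some (natsVal L)) (hL : L.length = c + 1) {x : ℕ} (hx : a.lookup x = none) :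
    ∃ K : Ectx,
      RunsTo (.app (.val (rpFun m u)) (.val (.int x))) h
        (K.fill (.rand (.val (.int c)))) h ∧
      ∀ (k : ℕ) (hk : k < L.length), RunsTo (K.fill (.val (.int k))) h (.val (.int L[k]))
        (Function.update (Function.update h m (some (assocVal ((x, L[k]) :: a)))) u
          (some (natsVal (L.eraseIdx k)))) := by
  have hget := runsTo_mapGet hm x
  rw [hx] at hget
  apply Exists.intro [.appR _, .appR _]
  refine ⟨?_, fun k hk => ?_⟩
  · apply RunsTo.app (.refl _ _) (.refl _ _)
    apply RunsTo.frame (.appR _)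
    apply RunsTo.ite
    · exact .binop (.inl (.refl _ _)) hget (binopEval_eq_inl_unit _ true (by simp [optVal]))
    · have hlen := runsTo_listLength (L.map fun n : ℕ => .int n) h
      rw [List.length_map, hL] at hlen
      apply RunsTo.letIn (.app₁ (.load (.refl _ _) hu) (.refl _ _) hlen)
      exact .frame (.appR _) <| .frame .rand <|
        .binop (.refl _ _) (.refl _ _) (binopEval_sub_one c)
  · apply RunsTo.seq
    · apply RunsTo.app (.refl _ _) (.fix ..)
      apply RunsTo.letIn
      · have hnth := runsTo_listNth (L.map fun n : ℕ => .int n) k (by simpa using hk) h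
        rw [List.getElem_map] at hnth
        exact .content (.app₂ (.refl _ _) (.load (.refl _ _) hu) (.refl _ _) hnth)
      · apply RunsTo.seq (runsTo_mapSet hm x L[k])
        have hu' : Function.update h m (some (assocVal ((x, L[k]) :: a))) u
            = some (natsVal L) := by rw [Function.update_of_ne hmu.symm, hu]
        have hrem := runsTo_listRemoveNth (L.map fun n : ℕ => .int n) k
          (Function.update h m (some (assocVal ((x, L[k]) :: a))))
        rw [List.eraseIdx_map] at hrem
        exact .store (.app₂ (.refl _ _) (.load (.refl _ _) hu') (.refl _ _) hrem) (.refl _ _) hu'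
    · have hget' := runsTo_mapGet (m := m) (a := (x, L[k]) :: a)
        (h := Function.update (Function.update h m (some (assocVal ((x, L[k]) :: a)))) u
          (some (natsVal (L.eraseIdx k)))) (by simp [hmu]) x
      rw [List.lookup_cons_self] at hget'
      exact .content hget'

end Query

/-! ### The adversary -/

/-- The loop of the adversary, with the list of query-answer pairs at location `l`. -/
def advLoop (N Q : ℕ) (f : Val) (l : Loc) : Val :=
  .fix (some xrec) (some xi) <|
    .ite (.binop .lt (var xi) (int Q))
      (seq
        (letIn xx (.rand (.binop .sub (int N) (int 1))) <|
          letIn xy ((f : Expr) (var xx)) <|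
          .store (Val.loc l) (cons (.pair (var xx) (var xy)) (.load (Val.loc l))))
        (var xrec (.binop .add (var xi) (int 1))))
      unit

/-- The rest of the adversary's program from the `i`-th iteration of the loop on. -/
def advFrom (N Q : ℕ) (f : Val) (l : Loc) (i : ℕ) : Expr :=
  seq ((advLoop N Q f l : Expr) (int i)) (.load (Val.loc l))

/-- The setup of the adversary, split at its allocation. -/
theorem weakAdv_runsTo (N Q : ℕ) (f : Val) : ∃ K : Ectx,
    (∀ h, RunsTo ((weakAdv : Expr) (int N) (int Q) f) h
      (K.fill (.allocN (.val (.int 1)) (.val (listVal [])))) h) ∧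
    ∀ l h, RunsTo (K.fill (.val (.loc l))) h (advFrom N Q f l 0) h := by
  apply Exists.intro [.appR _]
  refine ⟨fun h => ?_, fun l h => ?_⟩
  · apply RunsTo.app (.refl _ _)
    · apply RunsTo.app (.refl _ _)
      · exact .app (.refl _ _) (.refl _ _) (.fix ..)
      · exact .fix ..
    · exact RunsTo.frame (.appR _) <| RunsTo.frame (.allocNR _) (.inl (.refl _ _))
  · apply RunsTo.app (.refl _ _) (.fix ..)
    exact RunsTo.frame (.appR _) (.frame (.appL _) (.fix ..))

theorem advFrom_done (N Q : ℕ) (f : Val) {l : Loc} {h : PHeap} {w : Val} (hl : h l = some w) :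
    RunsTo (advFrom N Q f l Q) h (.val w) h := by
  apply RunsTo.seq
  · apply RunsTo.app (.refl _ _) (.refl _ _)
    apply RunsTo.ite
    · exact .binop (.refl _ _) (.refl _ _) (u := .bool false) (by simp [binopEval])
    · exact .refl _ _
  · exact .load (.refl _ _) hl

/-- An iteration of the loop samples `x`, evaluates `f x`, and records the answer `y`. -/
theorem advFrom_iterate {n Q : ℕ} (f : Val) (l : Loc) {i : ℕ} (hi : i < Q) : ∃ K : Ectx,
    (∀ h, RunsTo (advFrom (n + 1) Q f l i) h (K.fill (.rand (.val (.int n)))) h) ∧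
    ∀ x : ℕ, ∃ K₂ : Ectx,
      (∀ h, RunsTo (K.fill (.val (.int x))) h
        (K₂.fill (.app (.val f) (.val (.int x)))) h) ∧
      ∀ (y : ℕ) (h : PHeap) (w : Val), h l = some w →
        RunsTo (K₂.fill (.val (.int y))) h (advFrom (n + 1) Q f l (i + 1))
          (Function.update h l (some (.inr (.pair (.pair (.int x) (.int y)) w)))) := by
  apply Exists.intro [.appR _, .appR _, .appR _]
  refine ⟨fun h => ?_, fun x => ?_⟩
  · apply RunsTo.frame (.appR _)
    apply RunsTo.app (.refl _ _) (.refl _ _)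
    apply RunsTo.ite
    · exact .binop (.refl _ _) (.refl _ _) (u := .bool true) (by simp [binopEval, hi])
    · exact .frame (.appR _) <| .frame (.appR _) <| .frame .rand <|
        .binop (.refl _ _) (.refl _ _) (binopEval_sub_one n)
  · apply Exists.intro [.appR _, .appR _, .appR _]
    refine ⟨fun h => ?_, fun y h w hl => ?_⟩
    · apply RunsTo.frame (.appR _)
      apply RunsTo.frame (.appR _)
      apply RunsTo.app (.refl _ _) (.fix ..)
      exact .refl _ _
    · apply RunsTo.frame (.appR _)
      apply RunsTo.seq
      · apply RunsTo.app (.refl _ _) (.fix ..)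
        exact .store (.cons (.load (.refl _ _) hl) (.pair (.refl _ _) (.refl _ _))) (.refl _ _) hl
      · refine .app₁ (.binop (.refl _ _) (.refl _ _) (u := .int (i + 1 : ℕ)) ?_) (.refl _ _)
          (.refl _ _)
        simp [binopEval]

/-! ### Coupling the random permutation with the random function -/

/-- The invariant after at most `i` queries to a permutation and a function on `{0, …, n}`: both
maps, at `m` and `m'`, hold the same association list `a` with distinct keys, and the list `L` at
`u` enumerates, without repetition, as many values as there are keys left. -/
def QueryInv (n : ℕ) (m u m' : Loc) (i : ℕ) (h h' : PHeap) : Prop :=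
  ∃ (a : List (ℕ × ℕ)) (L : List ℕ), h m = some (assocVal a) ∧ h u = some (natsVal L) ∧
    h' m' = some (assocVal a) ∧ L.Nodup ∧ (∀ y ∈ L, y ≤ n) ∧ (∀ p ∈ a, p.1 ≤ n) ∧
    (a.map Prod.fst).Nodup ∧ a.length + L.length = n + 1 ∧ a.length ≤ i

theorem QueryInv.congr {n : ℕ} {m u m' : Loc} {i : ℕ} {h h' h₂ h₂' : PHeap}
    (H : QueryInv n m u m' i h h') (hm : h₂ m = h m) (hu : h₂ u = h u) (hm' : h₂' m' = h' m') :
    QueryInv n m u m' i h₂ h₂' := by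
  unfold QueryInv
  rwa [hm, hu, hm']

/-- A key that does not occur in an association list with distinct keys leaves room for one. -/
theorem length_le_of_lookup_eq_none {n x : ℕ} {a : List (ℕ × ℕ)} (hx : x ≤ n)
    (ha : ∀ p ∈ a, p.1 ≤ n) (hnd : (a.map Prod.fst).Nodup) (hl : a.lookup x = none) :
    x ∉ a.map Prod.fst ∧ a.length ≤ n := by
  have hxa : x ∉ a.map Prod.fst := by
    rw [List.lookup_eq_none_iff] at hl
    rintro hmem
    obtain ⟨p, hp, rfl⟩ := List.mem_map.1 hmem
    simpa using hl p hp
  refine ⟨hxa, ?_⟩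
  have hsub : (x :: a.map Prod.fst) ⊆ List.range (n + 1) := by
    intro z hz
    rw [List.mem_range]
    rcases List.mem_cons.1 hz with rfl | hz
    · omega
    · obtain ⟨p, hp, rfl⟩ := List.mem_map.1 hz
      have := ha p hp
      omega
  have := ((List.nodup_cons.2 ⟨hxa, hnd⟩).subperm hsub).length_le
  simpa using this

/-- A query costs nothing if the key is known; otherwise the position in the list of unused values
is coupled with the value at that position, and the error is the probability that the random
function picks a used value. -/
theorem coupled_query {n : ℕ} {m u m' : Loc} (hmu : m ≠ u) {i : ℕ} {h h' : PHeap}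
    (H : QueryInv n m u m' i h h') {x : ℕ} (hx : x ≤ n) {δ : ℝ≥0} (K K' : Ectx)
    (hK : ∀ (y : ℕ) (h₂ h₂' : PHeap), QueryInv n m u m' (i + 1) h₂ h₂' →
      (∀ l, l ≠ m → l ≠ u → h₂ l = h l) → (∀ l, l ≠ m' → h₂' l = h' l) →
      Coupled (K.fill (.val (.int y))) h₂ (K'.fill (.val (.int y))) h₂' δ) :
    Coupled (K.fill (.app (.val (rpFun m u)) (.val (.int x)))) h
      (K'.fill (.app (.val (rfFun (n + 1) m')) (.val (.int x)))) h'
      ((i : ℝ≥0) / ((n + 1 : ℕ) : ℝ≥0) + δ) := by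
  obtain ⟨a, L, hm, hu, hm', hLnd, hLn, han, hand, hlen, hai⟩ := H
  cases hlk : a.lookup x with
  | some y =>
    refine Coupled.runsTo ((rpFun_hit u hm hlk).fill K) ((rfFun_hit (n + 1) hm' hlk).fill K') ?_
    refine (hK y h h' ⟨a, L, hm, hu, hm', hLnd, hLn, han, hand, hlen, by omega⟩
      (fun _ _ _ => rfl) (fun _ _ => rfl)).mono le_add_self
  | none =>
    obtain ⟨hxa, hle⟩ := length_le_of_lookup_eq_none hx han hand hlk
    -- A fresh key leaves an unused value, so the permutation does not get stuck.
    obtain ⟨c, hc⟩ : ∃ c, L.length = c + 1 := ⟨L.length - 1, by omega⟩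
    obtain ⟨K₁, hr, hr₂⟩ := rpFun_miss hmu hm hu hc hlk
    obtain ⟨K₁', hr', hr₂'⟩ := rfFun_miss n hm' hlk
    refine Coupled.runsTo (hr.fill K) (hr'.fill K') ?_
    rw [← Ectx.fill_append, ← Ectx.fill_append]
    let g : Fin (c + 1) → Fin (n + 1) := fun k =>
      ⟨L[(k : ℕ)]'(by omega), Nat.lt_succ_of_le (hLn _ (List.getElem_mem _))⟩
    have hg : Function.Injective g := fun k j hkj => by
      have : L[(k : ℕ)]'(by omega) = L[(j : ℕ)]'(by omega) := congrArg Fin.val hkj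
      exact Fin.ext (hLnd.getElem_inj_iff.1 this)
    refine Coupled.rand (δ := δ) (K ++ K₁) (K' ++ K₁') (arcoupl_unif_injective hg)
      (arcoupl_unif_injective_symm hg) ?_ fun k j hkj => ?_
    · gcongr
      omega
    · have hk : (k : ℕ) < L.length := by omega
      have hj : (j : ℕ) = L[(k : ℕ)] := (congrArg Fin.val hkj).symm
      rw [Ectx.fill_append, Ectx.fill_append]
      refine Coupled.runsTo ((hr₂ k hk).fill K) ((hr₂' j).fill K') ?_
      rw [hj]
      refine hK L[(k : ℕ)] _ _ ⟨(x, L[(k : ℕ)]) :: a, L.eraseIdx k, ?_, ?_, ?_,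
        hLnd.sublist (List.eraseIdx_sublist ..), fun y hy => hLn y (List.mem_of_mem_eraseIdx hy),
        ?_, ?_, ?_, ?_⟩ (fun l h₁ h₂ => ?_) (fun l h₁ => ?_)
      · simp [hmu]
      · simp
      · simp
      · intro p hp
        rcases List.mem_cons.1 hp with rfl | hp
        · exact hx
        · exact han p hp
      · exact List.nodup_cons.2 ⟨hxa, hand⟩
      · rw [List.length_eraseIdx_of_lt hk, List.length_cons]
        omega
      · rw [List.length_cons]
        omega
      · rw [Function.update_of_ne h₂, Function.update_of_ne h₁]
      · rw [Function.update_of_ne h₁]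

/-- The error credits needed from the `i`-th query on: the `j`-th query costs at most `j / N`. -/
noncomputable def credits (N Q i : ℕ) : ℝ≥0 := ∑ j ∈ Finset.Ico i Q, (j : ℝ≥0) / (N : ℝ≥0)

theorem credits_eq_add {N Q i : ℕ} (hi : i < Q) :
    credits N Q i = (i : ℝ≥0) / (N : ℝ≥0) + credits N Q (i + 1) :=
  Finset.sum_eq_sum_Ico_succ_bot hi _

theorem credits_zero (N Q : ℕ) : credits N Q 0 = errBound N Q := by
  apply NNReal.eq
  change ((∑ j ∈ Finset.Ico 0 Q, (j : ℝ≥0) / (N : ℝ≥0) : ℝ≥0) : ℝ)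
    = (Q : ℝ) * ((Q : ℝ) - 1) / (2 * (N : ℝ))
  simp only [NNReal.coe_sum, NNReal.coe_div, NNReal.coe_natCast, Nat.Ico_zero_eq_range]
  induction Q with
  | zero => simp
  | succ Q ih =>
    rw [Finset.sum_range_succ, ih]
    push_cast
    ring

/-- The loops are coupled by induction on the number `d` of remaining queries. -/
theorem coupled_advFrom {n Q : ℕ} {m u m' l l' : Loc} (hmu : m ≠ u) (hlm : l ≠ m) (hlu : l ≠ u)
    (hlm' : l' ≠ m') (d : ℕ) : ∀ (i : ℕ) (h h' : PHeap) (w : Val), i + d = Q →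
      QueryInv n m u m' i h h' → h l = some w → h' l' = some w →
      Coupled (advFrom (n + 1) Q (rpFun m u) l i) h
        (advFrom (n + 1) Q (rfFun (n + 1) m') l' i) h' (credits (n + 1) Q i) := by
  induction d with
  | zero =>
    rintro i h h' w rfl _ hl hl'
    exact Coupled.runsTo (advFrom_done _ _ _ hl) (advFrom_done _ _ _ hl') (.val w h h' _)
  | succ d ih =>
    intro i h h' w hid H hl hl'
    have hi : i < Q := by omega
    obtain ⟨K, hr, hr₂⟩ := advFrom_iterate (n := n) (rpFun m u) l hi
    obtain ⟨K', hr', hr₂'⟩ := advFrom_iterate (n := n) (rfFun (n + 1) m') l' hi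
    refine Coupled.runsTo (hr h) (hr' h') ?_
    -- The adversary's own sampling is coupled along the identity, without error.
    refine Coupled.rand (ε₁ := 0) K K'
      (by simpa using arcoupl_unif_injective (n := n) Function.injective_id)
      (by simpa using arcoupl_unif_injective_symm (n := n) Function.injective_id)
      (zero_add _).le fun k j hkj => ?_
    obtain rfl : k = j := hkj
    obtain ⟨K₂, hq, hq₂⟩ := hr₂ k
    obtain ⟨K₂', hq', hq₂'⟩ := hr₂' k
    refine Coupled.runsTo (hq h) (hq' h') ?_
    rw [credits_eq_add hi]
    refine coupled_query hmu H (Nat.lt_succ_iff.1 k.2) K₂ K₂' fun y h₂ h₂' H₂ hf hf' => ?_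
    refine Coupled.runsTo (hq₂ y h₂ w ((hf l hlm hlu).trans hl))
      (hq₂' y h₂' w ((hf' l' hlm').trans hl')) ?_
    refine ih (i + 1) _ _ _ (by omega) (H₂.congr ?_ ?_ ?_) (Function.update_self ..)
      (Function.update_self ..)
    · rw [Function.update_of_ne hlm.symm]
    · rw [Function.update_of_ne hlu.symm]
    · rw [Function.update_of_ne hlm'.symm]

theorem coupled_advRP_advRF {N : ℕ} (Q : ℕ) (hN : 0 < N) :
    Coupled (advRP N Q) (fun _ => none) (advRF N Q) (fun _ => none) (errBound N Q) := by
  obtain ⟨n, rfl⟩ : ∃ n, N = n + 1 := ⟨N - 1, by omega⟩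
  obtain ⟨K₁, hp, hp₂⟩ := rpImpl_runsTo (n + 1)
  obtain ⟨K', hf, hf₂⟩ := rfImpl_runsTo (n + 1)
  let F : Frame := .appR ((weakAdv : Expr) (int (n + 1 : ℕ)) (int Q))
  refine Coupled.runsTo ((hp _).frame F) ((hf _).frame F) ?_
  refine Coupled.alloc_left (F :: K₁) fun m _ => ?_
  refine Coupled.alloc_right (F :: K') fun m' _ => ?_
  obtain ⟨K₂, hp₃, hp₄⟩ := hp₂ m
  refine Coupled.runsTo ((hp₃ _).frame F) ((hf₂ m' _).frame F) ?_
  refine Coupled.alloc_left (F :: K₂) fun u hu => ?_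
  have hmu : m ≠ u := by
    rintro rfl
    simp at hu
  obtain ⟨C, ha, ha₂⟩ := weakAdv_runsTo (n + 1) Q (rpFun m u)
  obtain ⟨C', ha', ha₂'⟩ := weakAdv_runsTo (n + 1) Q (rfFun (n + 1) m')
  refine Coupled.runsTo (((hp₄ u _).frame F).trans (ha _)) (ha' _) ?_
  refine Coupled.alloc_left C fun l hl => ?_
  refine Coupled.alloc_right C' fun l' hl' => ?_
  have hlu : l ≠ u := by
    rintro rfl
    simp at hl
  have hlm : l ≠ m := by
    rintro rfl
    simp [hmu] at hl
  have hlm' : l' ≠ m' := by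
    rintro rfl
    simp at hl'
  refine Coupled.runsTo (ha₂ l _) (ha₂' l' _) ?_
  rw [← credits_zero]
  refine coupled_advFrom hmu hlm hlu hlm' Q 0 _ _ (listVal []) (zero_add Q)
    ⟨[], List.range' 0 (n + 1), ?_, ?_, ?_, List.nodup_range', ?_, by simp, by simp, by simp,
      by simp⟩ (Function.update_self ..) (Function.update_self ..)
  · simp [hlm.symm, hmu]
  · simp [hlu.symm]
  · simp [hlm'.symm]
  · intro y hy
    simp only [List.mem_range'_1] at hy
    omega

end ProbLang

theorem mainTheorem6 (N Q : ℕ) (hN : 0 < N) :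
    (∀ (σ σ' : ProbLang.State) (v : ProbLang.Val),
      |(ProbLang.exec (ProbLang.advRP N Q, σ) v).toReal -
          (ProbLang.exec (ProbLang.advRF N Q, σ') v).toReal| ≤
        (Q : ℝ) * ((Q : ℝ) - 1) / (2 * (N : ℝ))) ∧
    ProbLang.IProp.Entails (ProbLang.upto (ProbLang.errBound N Q))
      (ProbLang.wpRef (ProbLang.advRP N Q) (ProbLang.advRF N Q)
        fun v v' => ProbLang.IProp.pure (v = v')) ∧
    ProbLang.IProp.Entails (ProbLang.upto (ProbLang.errBound N Q))
      (ProbLang.wpRef (ProbLang.advRF N Q) (ProbLang.advRP N Q)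
        fun v v' => ProbLang.IProp.pure (v = v')) := by
  have H := ProbLang.coupled_advRP_advRF Q hN
  exact ⟨fun σ σ' v => H.abs_exec_sub_le nofun nofun v, H.entails_wpRef, H.symm.entails_wpRef⟩
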